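/- Let $(E,g)$ be a real vector space of finite dimension $n$ endowed with a non-degenerate symmetric bilinear form $g$ (of any signature), and let $O_g$ be the group of linear isometries $(E,g)\to(E,g)$. Let $m\ge 0$ be an integer, and let $\mathsf{A}^g_m$ be the $\mathbb{R}$-algebra of polynomial functions $f\colon E^m\to\mathbb{R}$ that are invariant under the diagonal action of $O_g$, i.e. $f(\sigma e_1,\dots,\sigma e_m)=f(e_1,\dots,e_m)$ for all $\sigma\in O_g$ and $e_1,\dots,e_m\in E$. For $1\le i,j\le m$ let $y_{ij}\colon E^m\to\mathbb{R}$, $y_{ij}(e_1,\dots,e_m)=g(e_i,e_j)$. 1. The algebra $\mathsf{A}^g_m$ is generated by the functions $y_{ij}$ with $1\le i\le j\le m$. 2. Let $Y_{ij}=Y_{ji}$ ($1\le i\le j\le m$) be free symmetric variables, and let $J_{n+1}\subset\mathbb{R}[Y_{ij}]$ be the ideal generated by all the $(n+1)\times(n+1)$ minors $$\det\big(Y_{i_a j_b}\big)_{0\le a,b\le n},\qquad 1\le i_0<\dots<i_n\le m,\quad 1\le j_0<\dots<j_n\le m,$$ of the symmetric matrix $(Y_{ij})$ (so $J_{n+1}=0$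 if $m\le n$). The map $Y_{ij}\mapsto y_{ij}$ induces an isomorphism of $\mathbb{R}$-algebras $$\mathbb{R}[Y_{ij}]/J_{n+1}\;\simeq\;\mathsf{A}^g_m .$$ 3. In particular, if $m\le n$, the functions $y_{ij}$ with $1\le i\le j\le m$ are algebraically independent over $\mathbb{R}$. -/

import Mathlib

namespace OrthogonalInvariants

noncomputable section

/-- The group of linear isometries of `(E, g)`. -/
def isometryGroup {E : Type*} [AddCommGroup E] [Module ℝ E] (g : LinearMap.BilinForm ℝ E) :
    Subgroup (E ≃ₗ[ℝ] E) where
  carrier := {A | ∀ v w : E, g (A v) (A w) = g v w}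
  one_mem' := fun _ _ => rfl
  mul_mem' := fun {A B} hA hB v w => (hA (B v) (B w)).trans (hB v w)
  inv_mem' := fun {A} hA v w => by
    have h := hA (A.symm v) (A.symm w)
    rw [A.apply_symm_apply, A.apply_symm_apply] at h
    exact h.symm

/-- The algebra of polynomial functions on a real vector space `V`: the algebra of functions
`V → ℝ` generated by the linear forms. -/
def polynomialFunctions (V : Type*) [AddCommGroup V] [Module ℝ V] : Subalgebra ℝ (V → ℝ) :=
  Algebra.adjoin ℝ (Set.range fun φ : Module.Dual ℝ V => (φ : V → ℝ))

/-- The algebra of polynomial functions on `m` vectors of `E` that are invariant under the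
diagonal action of the isometry group of `g`. -/
def invariantPolynomials {E : Type*} [AddCommGroup E] [Module ℝ E] (g : LinearMap.BilinForm ℝ E)
    (m : ℕ) : Subalgebra ℝ ((Fin m → E) → ℝ) where
  carrier := {f | f ∈ polynomialFunctions (Fin m → E) ∧
    ∀ A ∈ isometryGroup g, ∀ e : Fin m → E, f (fun i => A (e i)) = f e}
  mul_mem' := fun {a b} ha hb => ⟨mul_mem ha.1 hb.1, fun A hA e => by
    rw [Pi.mul_apply, Pi.mul_apply, ha.2 A hA e, hb.2 A hA e]⟩
  add_mem' := fun {a b} ha hb => ⟨add_mem ha.1 hb.1, fun A hA e => by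
    rw [Pi.add_apply, Pi.add_apply, ha.2 A hA e, hb.2 A hA e]⟩
  algebraMap_mem' := fun r => ⟨Subalgebra.algebraMap_mem _ r, fun _ _ _ => rfl⟩

/-- The function `y i j (e₁, …, eₘ) = g (e i, e j)`. -/
def metricFunction {E : Type*} [AddCommGroup E] [Module ℝ E] (g : LinearMap.BilinForm ℝ E)
    {m : ℕ} (i j : Fin m) : (Fin m → E) → ℝ :=
  fun e => g (e i) (e j)

/-- The pairs `(i, j)` with `i ≤ j`, which index the free symmetric variables. -/
abbrev SymIndex (m : ℕ) : Type := {p : Fin m × Fin m // p.1 ≤ p.2}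

/-- The symmetric `m × m` matrix of the free symmetric variables `Y i j = Y j i`. -/
def symVar (m : ℕ) : Matrix (Fin m) (Fin m) (MvPolynomial (SymIndex m) ℝ) :=
  Matrix.of fun i j => MvPolynomial.X ⟨(min i j, max i j), min_le_max⟩

/-- The ideal generated by the `k × k` minors of the matrix of free symmetric variables
(rows and columns chosen independently, each in increasing order). -/
def minorIdeal (m k : ℕ) : Ideal (MvPolynomial (SymIndex m) ℝ) :=
  Ideal.span {d | ∃ r c : Fin k ↪o Fin m, d = ((symVar m).submatrix r c).det}

end

end OrthogonalInvariants

/-! By Sylvester's law (`exists_diagForm`), g may be taken diagonal with coefficients ε = ±1 on ℝ^N,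
N = n. The theorem then concerns the algebra map `gramHom ε`, which sends Y_ij to the Gram entry x_i
· x_j: its image is the space of invariants (`diagInvariants_le_range_gramHom`) and its kernel is
the ideal of minors (`ker_gramHom`).

Both claims have the form K ≤ I, for spaces stable under the gl_m-action by polarization operators
D_ij, which replace the index j by i. `le_of_highestWeight_mem` reduces such an inclusion to highest
weight vectors, those killed by all D_ij with i < j. Complete reducibility is replaced by the
Fischer form: it is positive definite and makes D_ij adjoint to D_ji.

Highest weight vectors among the invariants can be written down. Such an f is unchanged when
multiples of x_i are added to later vectors, is rescaled when a vector is rescaled, and is invariant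
under reflections. Hence Gram–Schmidt near the standard frame shows that f is determined by its
value there (`eq_zero_of_eval_stdFrame`). If this value is nonzero, the weight is even and vanishes
from position N on, and f is proportional to a product of leading minors of the Gram matrix
(`exists_eq_gramHom_leadProd`). This gives generation.

For the relations, a highest weight vector p of the kernel is mapped to polynomials in m vectors of
a hyperbolic space of dimension 2m. There the Gram map is injective, since every symmetric matrix is
a Gram matrix, so p itself is c times a product of leading minors. Either a minor of size at least N
+ 1 occurs and p lies in the ideal, or the product does not vanish at the standard frame of ℝ^N and
c = 0. -/

namespace OrthogonalInvariants

noncomputable section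

open MvPolynomial

/-! ### The weighted Fischer form -/

section Fischer

variable {σ : Type*} [Fintype σ]

/-- The norm of the monomial with exponent `α` in the Fischer form with weights `w`. -/
def fischerNorm (w : σ → ℝ) (α : σ →₀ ℕ) : ℝ :=
  ∏ s, ((α s).factorial : ℝ) * w s ^ α s

/-- The Fischer form on polynomials, with weights `w`: the bilinear form for which multiplication
by `X s` is adjoint to `w s` times the partial derivative with respect to `X s`. -/
def fischer (w : σ → ℝ) : MvPolynomial σ ℝ →ₗ[ℝ] MvPolynomial σ ℝ →ₗ[ℝ] ℝ :=
  (basisMonomials σ ℝ).constr ℝ fun α => fischerNorm w α • lcoeff ℝ α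

theorem fischerNorm_pos {w : σ → ℝ} (hw : ∀ s, 0 < w s) (α : σ →₀ ℕ) : 0 < fischerNorm w α :=
  Finset.prod_pos fun s _ => mul_pos (by positivity) (pow_pos (hw s) _)

theorem fischer_monomial (w : σ → ℝ) (α : σ →₀ ℕ) (a : ℝ) (q : MvPolynomial σ ℝ) :
    fischer w (monomial α a) q = a * (fischerNorm w α * coeff α q) := by
  have h : monomial α a = a • basisMonomials σ ℝ α := by simp [smul_monomial]
  rw [h, map_smul, fischer, Module.Basis.constr_basis]
  simp [lcoeff]

theorem fischer_apply (w : σ → ℝ) (p q : MvPolynomial σ ℝ) :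
    fischer w p q = ∑ α ∈ p.support, coeff α p * (fischerNorm w α * coeff α q) := by
  conv_lhs => rw [p.as_sum, map_sum, LinearMap.sum_apply]
  exact Finset.sum_congr rfl fun α _ => fischer_monomial w α _ q

theorem fischer_comm (w : σ → ℝ) (p q : MvPolynomial σ ℝ) : fischer w p q = fischer w q p := by
  induction p using MvPolynomial.induction_on' with
  | add p₁ p₂ h₁ h₂ => simp [h₁, h₂]
  | monomial α a =>
    induction q using MvPolynomial.induction_on' with
    | add p₁ p₂ h₁ h₂ => simp [h₁, h₂]
    | monomial β b =>
      classical
      rw [fischer_monomial, fischer_monomial, coeff_monomial, coeff_monomial]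
      by_cases h : α = β
      · subst h; simp; ring
      · simp [h, Ne.symm h]

/-- The form is diagonal in the monomial basis with positive diagonal entries, hence positive
definite. -/
theorem eq_zero_of_fischer_self {w : σ → ℝ} (hw : ∀ s, 0 < w s) {p : MvPolynomial σ ℝ}
    (h : fischer w p p = 0) : p = 0 := by
  rw [fischer_apply, Finset.sum_eq_zero_iff_of_nonneg] at h
  · ext α
    by_contra hα
    have h1 := h α (mem_support_iff.2 hα)
    have h2 := fischerNorm_pos hw α
    simp only [coeff_zero] at hα
    simp [h2.ne', hα] at h1
  · intro α _
    have := (fischerNorm_pos hw α).le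
    nlinarith [mul_nonneg this (mul_self_nonneg (coeff α p))]

theorem fischerNorm_add_single (w : σ → ℝ) (α : σ →₀ ℕ) (s : σ) :
    fischerNorm w (α + Finsupp.single s 1) = w s * (fischerNorm w α * (α s + 1)) := by
  classical
  unfold fischerNorm
  rw [← Finset.mul_prod_erase _ _ (Finset.mem_univ s),
    ← Finset.mul_prod_erase (a := s) _ (fun s => ((α s).factorial : ℝ) * w s ^ α s)
      (Finset.mem_univ s)]
  have : ∀ t ∈ Finset.univ.erase s, (((α + Finsupp.single s 1 : σ →₀ ℕ) t).factorial : ℝ) *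
      w t ^ (α + Finsupp.single s 1 : σ →₀ ℕ) t = ((α t).factorial : ℝ) * w t ^ α t := by
    intro t ht
    simp [Finsupp.single_eq_of_ne (Finset.ne_of_mem_erase ht)]
  rw [Finset.prod_congr rfl this]
  simp [Nat.factorial_succ, pow_succ]
  ring

/-- Adding one to the exponent of s multiplies the norm by w s (α s + 1), and α s + 1 is the factor
produced by ∂_s; `fischerNorm` is designed for this. -/
theorem fischer_X_mul (w : σ → ℝ) (s : σ) (p q : MvPolynomial σ ℝ) :
    fischer w (X s * p) q = w s * fischer w p (pderiv s q) := by
  induction p using MvPolynomial.induction_on' with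
  | add p₁ p₂ h₁ h₂ => simp [mul_add, h₁, h₂]
  | monomial α a =>
    rw [mul_comm, X, monomial_mul, fischer_monomial, fischer_monomial, coeff_pderiv,
      fischerNorm_add_single]
    ring

/-- Orthogonal projection to a finite-dimensional subspace for the Fischer form. -/
theorem exists_fischer_projection {w : σ → ℝ} (hw : ∀ s, 0 < w s)
    (S : Submodule ℝ (MvPolynomial σ ℝ)) [FiniteDimensional ℝ S] (f : MvPolynomial σ ℝ) :
    ∃ q ∈ S, ∀ r ∈ S, fischer w (f - q) r = 0 := by
  -- A positive definite form restricted to the finite-dimensional S identifies S with its dual; q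
  -- represents the functional ⟨f, ·⟩ on S.
  let T : S →ₗ[ℝ] Module.Dual ℝ S := (fischer w).domRestrict₁₂ S S
  have hinj : Function.Injective T := by
    rw [injective_iff_map_eq_zero]
    intro x hx
    have h : T x x = 0 := by rw [hx]; rfl
    exact Subtype.ext (eq_zero_of_fischer_self hw h)
  have hsurj := (LinearMap.injective_iff_surjective_of_finrank_eq_finrank
    (Subspace.dual_finrank_eq (K := ℝ) (V := S)).symm).1 hinj
  obtain ⟨q, hq⟩ := hsurj ((fischer w f).domRestrict S)
  refine ⟨q, q.2, fun r hr => ?_⟩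
  have := LinearMap.congr_fun hq ⟨r, hr⟩
  rw [map_sub, LinearMap.sub_apply, sub_eq_zero]
  exact this.symm

end Fischer

/-! ### Weights -/

section Weights

variable {σ τ M : Type*} [AddCommMonoid M]

theorem IsWeightedHomogeneous.algHom {wt : σ → M} {wt' : τ → M}
    (φ : MvPolynomial σ ℝ →ₐ[ℝ] MvPolynomial τ ℝ)
    (hφ : ∀ s, IsWeightedHomogeneous wt' (φ (X s)) (wt s)) {p : MvPolynomial σ ℝ} {μ : M}
    (hp : IsWeightedHomogeneous wt p μ) : IsWeightedHomogeneous wt' (φ p) μ := by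
  induction hp using IsWeightedHomogeneous.induction_on with
  | zero => simpa using isWeightedHomogeneous_zero ℝ wt' μ
  | add p q _ _ hp hq => simpa using hp.add hq
  | monomial α a hα =>
    rw [monomial_eq, map_mul, ← algebraMap_eq, AlgHom.commutes, algebraMap_eq, Finsupp.prod,
      map_prod]
    refine IsWeightedHomogeneous.C_mul ?_ a
    have h := IsWeightedHomogeneous.prod α.support (fun s => φ (X s ^ α s)) (fun s => α s • wt s)
      (w := wt') fun s _ => by rw [map_pow]; exact (hφ s).pow _
    rwa [← hα, Finsupp.weight_apply]

theorem algHom_weightedHomogeneousComponent {wt : σ → M} {wt' : τ → M}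
    (φ : MvPolynomial σ ℝ →ₐ[ℝ] MvPolynomial τ ℝ)
    (hφ : ∀ s, IsWeightedHomogeneous wt' (φ (X s)) (wt s)) (μ : M) (p : MvPolynomial σ ℝ) :
    φ (weightedHomogeneousComponent wt μ p) = weightedHomogeneousComponent wt' μ (φ p) := by
  induction p using MvPolynomial.induction_on' with
  | add p q hp hq => simp [hp, hq]
  | monomial α a =>
    have h := isWeightedHomogeneous_monomial wt α a rfl
    have h' := IsWeightedHomogeneous.algHom φ hφ h
    by_cases hμ : μ = Finsupp.weight wt α
    · subst hμ
      rw [h.weightedHomogeneousComponent_same, h'.weightedHomogeneousComponent_same]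
    · rw [h.weightedHomogeneousComponent_ne μ hμ, h'.weightedHomogeneousComponent_ne μ hμ, map_zero]

theorem mem_of_weightedHomogeneousComponent_mem {wt : σ → M} {I : Submodule ℝ (MvPolynomial σ ℝ)}
    {p : MvPolynomial σ ℝ} (h : ∀ μ, weightedHomogeneousComponent wt μ p ∈ I) : p ∈ I := by
  rw [← sum_weightedHomogeneousComponent wt p]
  exact finsum_induction (fun q => q ∈ I) I.zero_mem (fun _ _ => I.add_mem) h

/-- Polynomials of different weights share no monomial, and distinct monomials are orthogonal. -/
theorem fischer_eq_zero_of_ne [Fintype σ] {wt : σ → M} (w : σ → ℝ) {p q : MvPolynomial σ ℝ}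
    {μ ν : M} (hp : IsWeightedHomogeneous wt p μ) (hq : IsWeightedHomogeneous wt q ν)
    (h : μ ≠ ν) : fischer w p q = 0 := by
  rw [fischer_apply]
  refine Finset.sum_eq_zero fun α hα => ?_
  have : coeff α q = 0 := hq.coeff_eq_zero α (by rwa [hp (mem_support_iff.1 hα)])
  rw [this, mul_zero, mul_zero]

theorem pderiv_eq_zero_or_exists_weight {wt : σ → M} {p : MvPolynomial σ ℝ} {μ : M}
    (hp : IsWeightedHomogeneous wt p μ) (s : σ) : pderiv s p = 0 ∨ ∃ ν, ν + wt s = μ := by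
  by_cases h : ∃ α, coeff α (pderiv s p) ≠ 0
  · obtain ⟨α, hα⟩ := h
    rw [coeff_pderiv] at hα
    right
    refine ⟨Finsupp.weight wt α, ?_⟩
    rw [← hp (left_ne_zero_of_mul hα), map_add, Finsupp.weight_single, one_smul]
  · left
    ext α
    by_contra h'
    exact h ⟨α, by simpa using h'⟩

/-- Summing the components of the weight gives a positive ℕ-valued weight, for which finiteness is
known. It makes the Fischer projection available on weight spaces. -/
theorem finite_weight_eq [Finite σ] {m : ℕ} (wt : σ → Fin m → ℕ) (hpos : ∀ s, ∑ i, wt s i ≠ 0)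
    (μ : Fin m → ℕ) : {α : σ →₀ ℕ | Finsupp.weight wt α = μ}.Finite := by
  refine (Finsupp.finite_of_nat_weight_eq (fun s => ∑ i, wt s i) hpos (∑ i, μ i)).subset ?_
  rintro α rfl
  simp only [Set.mem_ofPred_eq, Finsupp.weight_apply, Finsupp.sum, Finset.sum_apply, Pi.smul_apply,
    smul_eq_mul, Finset.mul_sum]
  exact Finset.sum_comm

theorem finiteDimensional_weightedHomogeneousSubmodule [Finite σ] {m : ℕ} (wt : σ → Fin m → ℕ)
    (hpos : ∀ s, ∑ i, wt s i ≠ 0) (μ : Fin m → ℕ) :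
    FiniteDimensional ℝ (weightedHomogeneousSubmodule ℝ wt μ) := by
  rw [weightedHomogeneousSubmodule_eq_finsupp_supported]
  have := (finite_weight_eq wt hpos μ).to_subtype
  exact Module.Finite.of_basis (basisRestrictSupport ℝ {d | Finsupp.weight wt d = μ})

end Weights

/-! ### Polarization operators -/

section Polarization

variable {σ κ : Type*} [Fintype κ] {m : ℕ}

/-- The polarization operator which replaces the index `j` by the index `i`, for variables
`X (v i k)` with weights `w`. -/
def polarization (v : Fin m → κ → σ) (w : σ → ℝ) (i j : Fin m) :
    Derivation ℝ (MvPolynomial σ ℝ) (MvPolynomial σ ℝ) :=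
  ∑ k, (C (w (v j k)) * X (v i k)) • pderiv (v j k)

theorem polarization_apply (v : Fin m → κ → σ) (w : σ → ℝ) (i j : Fin m) (p : MvPolynomial σ ℝ) :
    polarization v w i j p = ∑ k, C (w (v j k)) * (X (v i k) * pderiv (v j k) p) := by
  simp only [polarization, ← Derivation.coeFnAddMonoidHom_apply, map_sum, Finset.sum_apply]
  simp [mul_assoc]

/-- Moving the multiplication to the other side gives ∑ w w' ⟨∂_{jk} p, ∂_{ik} q⟩, which is
symmetric under exchanging (i, p) with (j, q). -/
theorem fischer_polarization [Fintype σ] (v : Fin m → κ → σ) (w : σ → ℝ) (i j : Fin m)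
    (p q : MvPolynomial σ ℝ) :
    fischer w (polarization v w i j p) q = fischer w p (polarization v w j i q) := by
  have key : ∀ i j p q, fischer w (polarization v w i j p) q =
      ∑ k, w (v j k) * (w (v i k) * fischer w (pderiv (v j k) p) (pderiv (v i k) q)) := by
    intro i j p q
    rw [polarization_apply, map_sum, LinearMap.sum_apply]
    refine Finset.sum_congr rfl fun k _ => ?_
    rw [C_mul', map_smul, LinearMap.smul_apply, fischer_X_mul, smul_eq_mul]
  rw [fischer_comm w p, key, key]
  refine Finset.sum_congr rfl fun k _ => ?_
  rw [fischer_comm w (pderiv (v j k) p)]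
  ring

/-- The term ρ k is the weight carried by the second index of a variable: zero for vector
coordinates, the k-th unit vector for symmetric variables. If μ j = 0 no variable with index j
occurs, and the derivative vanishes. -/
theorem polarization_weight {v : Fin m → κ → σ} (w : σ → ℝ) {wt : σ → Fin m → ℕ}
    {ρ : κ → Fin m → ℕ} (hwt : ∀ i k, wt (v i k) = Pi.single i 1 + ρ k) (i j : Fin m)
    {p : MvPolynomial σ ℝ} {μ : Fin m → ℕ} (hp : IsWeightedHomogeneous wt p μ) :
    polarization v w i j p = 0 ∨ ∃ μ', μ' + Pi.single j 1 = μ + Pi.single i 1 ∧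
      IsWeightedHomogeneous wt (polarization v w i j p) μ' := by
  by_cases hμ : μ j = 0
  · left
    rw [polarization_apply]
    refine Finset.sum_eq_zero fun k _ => ?_
    rcases pderiv_eq_zero_or_exists_weight hp (v j k) with h | ⟨ν, h⟩
    · rw [h, mul_zero, mul_zero]
    · rw [hwt] at h
      have := congrFun h j
      simp at this
      omega
  · right
    obtain ⟨μ₀, rfl⟩ : ∃ μ₀ : Fin m → ℕ, μ = μ₀ + Pi.single j 1 := by
      refine ⟨μ - Pi.single j 1, ?_⟩
      funext l
      rw [Pi.add_apply, Pi.sub_apply]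
      by_cases hl : l = j
      · subst hl; rw [Pi.single_eq_same]; omega
      · rw [Pi.single_eq_of_ne hl]; rfl
    refine ⟨μ₀ + Pi.single i 1, by abel, ?_⟩
    rw [polarization_apply]
    refine IsWeightedHomogeneous.sum _ _ _ fun k _ => IsWeightedHomogeneous.C_mul ?_ _
    rcases pderiv_eq_zero_or_exists_weight hp (v j k) with h | ⟨ν, h⟩
    · rw [h, mul_zero]; exact isWeightedHomogeneous_zero ℝ wt _
    · have h1 := (isWeightedHomogeneous_X ℝ wt (v i k)).mul (hp.pderiv h)
      rw [hwt] at h1 h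
      have h2 : ν + ρ k = μ₀ := by
        apply add_right_cancel (b := Pi.single j 1)
        rw [← h]; abel
      convert h1 using 1
      rw [← h2]; abel

theorem algHom_derivation_comm {σ τ : Type*} (φ : MvPolynomial σ ℝ →ₐ[ℝ] MvPolynomial τ ℝ)
    (D : Derivation ℝ (MvPolynomial σ ℝ) (MvPolynomial σ ℝ))
    (D' : Derivation ℝ (MvPolynomial τ ℝ) (MvPolynomial τ ℝ))
    (h : ∀ s, φ (D (X s)) = D' (φ (X s))) (p : MvPolynomial σ ℝ) : φ (D p) = D' (φ p) := by
  induction p using MvPolynomial.induction_on with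
  | C a => simp [← algebraMap_eq]
  | add p q hp hq => simp [hp, hq]
  | mul_X p s hp => simp [hp, h]

/-- A function of the weight which increases under raising operators. -/
def weightHeight (μ : Fin m → ℕ) : ℕ := ∑ i, (m - i) * μ i

theorem weightHeight_le (μ : Fin m → ℕ) : weightHeight μ ≤ m * ∑ i, μ i := by
  rw [weightHeight, Finset.mul_sum]
  exact Finset.sum_le_sum fun i _ => Nat.mul_le_mul_right _ (Nat.sub_le _ _)

theorem weightHeight_raise {i j : Fin m} (hij : i < j) {μ μ' : Fin m → ℕ}
    (h : μ' + Pi.single j 1 = μ + Pi.single i 1) :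
    ∑ l, μ' l = ∑ l, μ l ∧ weightHeight μ < weightHeight μ' := by
  constructor
  · have := congrArg (fun f : Fin m → ℕ => ∑ l, f l) h
    simpa [Finset.sum_add_distrib] using this
  · have := congrArg weightHeight h
    simp only [weightHeight, Pi.add_apply, mul_add, Finset.sum_add_distrib, Pi.single_apply,
      mul_ite, mul_one, mul_zero, Finset.sum_ite_eq', Finset.mem_univ, if_true] at this ⊢
    have := i.2; have := j.2
    have : (i : ℕ) < j := hij
    omega

theorem weightHeight_swap {i j : Fin m} (hij : i < j) {μ : Fin m → ℕ} (h : μ i < μ j) :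
    ∑ l, (μ ∘ Equiv.swap i j) l = ∑ l, μ l ∧
      weightHeight μ < weightHeight (μ ∘ Equiv.swap i j) := by
  refine ⟨Equiv.sum_comp (Equiv.swap i j) μ, ?_⟩
  unfold weightHeight
  rw [← Finset.add_sum_erase _ _ (Finset.mem_univ i), ← Finset.add_sum_erase (a := i) _ _
    (Finset.mem_univ i)]
  have hj : j ∈ Finset.univ.erase i := Finset.mem_erase.2 ⟨hij.ne', Finset.mem_univ j⟩
  rw [← Finset.add_sum_erase _ _ hj, ← Finset.add_sum_erase (a := j) _ _ hj]
  have : ∀ l ∈ (Finset.univ.erase i).erase j,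
      (m - (l : ℕ)) * (μ ∘ Equiv.swap i j) l = (m - (l : ℕ)) * μ l := by
    intro l hl
    simp only [Finset.mem_erase, Finset.mem_univ, and_true] at hl
    simp [Equiv.swap_apply_of_ne_of_ne hl.2 hl.1]
  rw [Finset.sum_congr rfl this]
  simp only [Function.comp_apply, Equiv.swap_apply_left, Equiv.swap_apply_right]
  obtain ⟨c, hc⟩ : ∃ c, m - (i : ℕ) = m - (j : ℕ) + (c + 1) :=
    ⟨j - i - 1, by have := j.2; have : (i : ℕ) < j := hij; omega⟩
  rw [hc]
  nlinarith

/-- If every highest weight vector of `K` lies in the submodule `I`, then `K ≤ I`. -/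
theorem le_of_highestWeight_mem [Fintype σ] {v : Fin m → κ → σ} {w : σ → ℝ} (hw : ∀ s, 0 < w s)
    {wt : σ → Fin m → ℕ} {ρ : κ → Fin m → ℕ} (hwt : ∀ i k, wt (v i k) = Pi.single i 1 + ρ k)
    (hpos : ∀ s, ∑ i, wt s i ≠ 0) {I K : Submodule ℝ (MvPolynomial σ ℝ)} (hIK : I ≤ K)
    (hIpol : ∀ i j, ∀ p ∈ I, polarization v w i j p ∈ I)
    (hKpol : ∀ i j, ∀ p ∈ K, polarization v w i j p ∈ K)
    (hIwt : ∀ μ, ∀ p ∈ I, weightedHomogeneousComponent wt μ p ∈ I)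
    (hKwt : ∀ μ, ∀ p ∈ K, weightedHomogeneousComponent wt μ p ∈ K)
    (S : Fin m → Fin m → MvPolynomial σ ℝ → MvPolynomial σ ℝ)
    (hS : ∀ i j p, S i j (S i j p) = p)
    (hSwt : ∀ i j p μ, IsWeightedHomogeneous wt p μ →
      IsWeightedHomogeneous wt (S i j p) (μ ∘ Equiv.swap i j))
    (hIS : ∀ i j, ∀ p ∈ I, S i j p ∈ I) (hKS : ∀ i j, ∀ p ∈ K, S i j p ∈ K)
    (hw_mem : ∀ p ∈ K, ∀ μ : Fin m → ℕ, Antitone μ → IsWeightedHomogeneous wt p μ →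
      (∀ i j, i < j → polarization v w i j p = 0) → p ∈ I) : K ≤ I := by
  -- Induction on the gap between `weightHeight μ` and its bound; raising operators and swaps of
  -- out-of-order entries preserve the total weight and shrink the gap.
  suffices H : ∀ n : ℕ, ∀ μ : Fin m → ℕ, m * ∑ i, μ i - weightHeight μ = n →
      ∀ p ∈ K, IsWeightedHomogeneous wt p μ → p ∈ I from fun p hp =>
    mem_of_weightedHomogeneousComponent_mem fun μ => H _ μ rfl _ (hKwt μ p hp)
      (weightedHomogeneousComponent_isWeightedHomogeneous μ p)
  intro n
  induction n using Nat.strong_induction_on with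
  | _ n ih =>
  rintro μ rfl p hp hpμ
  have ih' : ∀ μ', ∑ i, μ' i = ∑ i, μ i ∧ weightHeight μ < weightHeight μ' →
      ∀ p ∈ K, IsWeightedHomogeneous wt p μ' → p ∈ I := by
    rintro μ' ⟨h1, h2⟩
    refine ih _ ?_ μ' rfl
    have := weightHeight_le μ'
    rw [h1] at this ⊢
    omega
  by_cases hμ : Antitone μ
  · have := finiteDimensional_weightedHomogeneousSubmodule wt hpos μ
    have : FiniteDimensional ℝ (I ⊓ weightedHomogeneousSubmodule ℝ wt μ : Submodule ℝ _) :=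
      Submodule.finiteDimensional_inf_right _ _
    obtain ⟨q, hq, hortho⟩ := exists_fischer_projection hw
      (I ⊓ weightedHomogeneousSubmodule ℝ wt μ) p
    have hrK : p - q ∈ K := K.sub_mem hp (hIK hq.1)
    have hrμ : IsWeightedHomogeneous wt (p - q) μ := hpμ.sub hq.2
    -- Orthogonality was imposed only on the weight μ part of I; the other weights are orthogonal
    -- automatically.
    have hrI : ∀ r ∈ I, fischer w (p - q) r = 0 := by
      intro r hr
      rw [← LinearMap.mem_ker]
      refine mem_of_weightedHomogeneousComponent_mem (wt := wt) fun ν => ?_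
      rw [LinearMap.mem_ker]
      have hν := weightedHomogeneousComponent_isWeightedHomogeneous (w := wt) ν r
      by_cases h : μ = ν
      · subst h; exact hortho _ ⟨hIwt _ _ hr, hν⟩
      · exact fischer_eq_zero_of_ne w hrμ hν h
    -- With r = p - q, the raised vector D_ij r lies in I by induction, and I is stable under D_ji.
    -- So ⟨D_ij r, D_ij r⟩ = ⟨r, D_ji D_ij r⟩ = 0, and r is a highest weight vector.
    have hr : p - q ∈ I := by
      refine hw_mem _ hrK μ hμ hrμ fun i j hij => ?_
      refine eq_zero_of_fischer_self hw ?_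
      rw [fischer_polarization]
      refine hrI _ (hIpol _ _ _ ?_)
      rcases polarization_weight w hwt i j hrμ with h | ⟨μ', h, h'⟩
      · rw [h]; exact I.zero_mem
      · exact ih' μ' (weightHeight_raise hij h) _ (hKpol _ _ _ hrK) h'
    simpa using I.add_mem hr hq.1
  · obtain ⟨i, j, hij, h⟩ : ∃ i j, i < j ∧ μ i < μ j := by
      by_contra hcon
      push Not at hcon
      exact hμ fun i j hij => hij.eq_or_lt.elim (fun h => h ▸ le_rfl) (hcon i j)
    rw [← hS i j p]
    exact hIS _ _ _ (ih' _ (weightHeight_swap hij h) _ (hKS _ _ _ hp) (hSwt _ _ _ _ hpμ))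

end Polarization

end

end OrthogonalInvariants

namespace OrthogonalInvariants

noncomputable section

open MvPolynomial

/-! ### Derivations and determinants -/

section Determinant

variable {A : Type*} [CommRing A] {n : Type*} [Fintype n] [DecidableEq n]

theorem derivation_prod [Algebra ℝ A] {ι : Type*} [DecidableEq ι] (D : Derivation ℝ A A) (s : Finset ι)
    (f : ι → A) :
    D (∏ i ∈ s, f i) = ∑ p ∈ s, ∏ i ∈ s, Function.update f p (D (f p)) i := by
  induction s using Finset.induction_on with
  | empty => simp
  | insert a s ha ih =>
    rw [Finset.prod_insert ha, D.leibniz, ih, Finset.sum_insert ha, Finset.prod_insert ha,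
      Function.update_self, add_comm, smul_eq_mul, smul_eq_mul, mul_comm, Finset.mul_sum]
    congr 1
    · congr 1
      exact Finset.prod_congr rfl fun i hi => by
        rw [Function.update_of_ne (ne_of_mem_of_not_mem hi ha)]
    · refine Finset.sum_congr rfl fun p hp => ?_
      rw [Finset.prod_insert ha, Function.update_of_ne (ne_of_mem_of_not_mem hp ha).symm]

theorem derivation_det [Algebra ℝ A] (D : Derivation ℝ A A) (M : Matrix n n A) :
    D M.det = ∑ q, (M.updateCol q fun p => D (M p q)).det := by
  simp only [Matrix.det_apply]
  rw [map_sum, Finset.sum_comm]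
  refine Finset.sum_congr rfl fun σ _ => ?_
  rw [Units.smul_def, map_zsmul, derivation_prod, Finset.smul_sum]
  refine Finset.sum_congr rfl fun q _ => ?_
  rw [Units.smul_def]
  congr 1
  refine Finset.prod_congr rfl fun i _ => ?_
  by_cases h : i = q
  · subst h; simp
  · simp [h]

/-- By Cramer's rule the two sides are the traces of adj(M) B and B adj(M). -/
theorem sum_det_updateCol (M B : Matrix n n A) :
    ∑ q, (M.updateCol q fun p => B p q).det = ∑ p, (M.updateRow p (B p)).det := by
  have h1 : ∀ q, (M.updateCol q fun p => B p q).det = (M.adjugate * B) q q := by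
    intro q
    rw [← Matrix.cramer_apply, Matrix.cramer_eq_adjugate_mulVec]
    rfl
  have h2 : ∀ p, (M.updateRow p (B p)).det = (B * M.adjugate) p p := by
    intro p
    rw [← Matrix.cramer_transpose_apply, Matrix.cramer_eq_adjugate_mulVec,
      ← Matrix.adjugate_transpose, Matrix.mulVec_transpose]
    rfl
  simp only [h1, h2]
  exact Matrix.trace_mul_comm _ _

end Determinant

/-! ### Symmetric variables -/

section SymVar

variable {m : ℕ}

/-- The index of the symmetric variable `Y i j`. -/
def symIdx (i j : Fin m) : SymIndex m := ⟨(min i j, max i j), min_le_max⟩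

/-- The Fischer weights of the symmetric variables. -/
def symFischerWeight (s : SymIndex m) : ℝ := if s.1.1 = s.1.2 then 2 else 1

/-- The weight of a symmetric variable. -/
def symWeight (s : SymIndex m) : Fin m → ℕ := Pi.single s.1.1 1 + Pi.single s.1.2 1

theorem symVar_apply (i j : Fin m) : symVar m i j = X (symIdx i j) := rfl

theorem symVar_comm (i j : Fin m) : symVar m i j = symVar m j i := by
  simp only [symVar_apply, symIdx, min_comm i j, max_comm i j]

theorem symIdx_val (s : SymIndex m) : symIdx s.1.1 s.1.2 = s := by
  obtain ⟨⟨i, j⟩, h⟩ := s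
  simp [symIdx, min_eq_left h, max_eq_right h]

theorem X_eq_symVar (s : SymIndex m) : X s = symVar m s.1.1 s.1.2 := by
  rw [symVar_apply, symIdx_val]

theorem symIdx_eq_iff {i j a b : Fin m} :
    symIdx i j = symIdx a b ↔ (i = a ∧ j = b) ∨ (i = b ∧ j = a) := by
  simp only [symIdx, Subtype.mk.injEq, Prod.mk.injEq]
  constructor
  · rintro ⟨h1, h2⟩
    rcases le_total i j with h | h <;> rcases le_total a b with h' | h' <;>
      simp_all
  · rintro (⟨rfl, rfl⟩ | ⟨rfl, rfl⟩)
    · simp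
    · exact ⟨min_comm _ _, max_comm _ _⟩

theorem symFischerWeight_pos (s : SymIndex m) : 0 < symFischerWeight s := by
  unfold symFischerWeight; split_ifs <;> norm_num

theorem symFischerWeight_symIdx (i j : Fin m) :
    symFischerWeight (symIdx i j) = if i = j then 2 else 1 := by
  unfold symFischerWeight symIdx
  simp only [inf_eq_sup]

theorem symWeight_symIdx (i j : Fin m) :
    symWeight (symIdx i j) = Pi.single i 1 + Pi.single j 1 := by
  unfold symWeight symIdx
  rcases le_total i j with h | h
  · simp [h]
  · simp [h, add_comm]

theorem sum_symWeight_ne_zero (s : SymIndex m) : ∑ i, symWeight s i ≠ 0 := by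
  simp [symWeight, Finset.sum_add_distrib]

theorem symVar_isWeightedHomogeneous (i j : Fin m) :
    IsWeightedHomogeneous symWeight (symVar m i j) (Pi.single i 1 + Pi.single j 1) := by
  rw [← symWeight_symIdx]
  exact isWeightedHomogeneous_X ℝ _ _

/-- The polarization operators on polynomials in symmetric variables. -/
def symPol (i j : Fin m) :
    Derivation ℝ (MvPolynomial (SymIndex m) ℝ) (MvPolynomial (SymIndex m) ℝ) :=
  polarization symIdx symFischerWeight i j

/-- The operator treats Y_ab as a product x_a · x_b. On Y_jj the product rule gives 2 Y_ij, which
forces the Fischer weight 2 on the diagonal. -/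
theorem symPol_symVar (i j a b : Fin m) : symPol i j (symVar m a b) =
    (if a = j then symVar m i b else 0) + (if b = j then symVar m a i else 0) := by
  classical
  have key : ∀ k, C (symFischerWeight (symIdx j k)) *
      (X (symIdx i k) * pderiv (symIdx j k) (X (symIdx a b))) =
      if (j = a ∧ k = b) ∨ (j = b ∧ k = a) then
        C (if j = k then 2 else 1) * symVar m i k else 0 := by
    intro k
    rw [pderiv_X, Pi.single_apply, symFischerWeight_symIdx]
    have : (symIdx a b = symIdx j k) ↔ ((j = a ∧ k = b) ∨ (j = b ∧ k = a)) := by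
      rw [eq_comm, symIdx_eq_iff]
    simp only [this, symVar_apply]
    split_ifs <;> simp
  rw [symPol, polarization_apply, symVar_apply, Finset.sum_congr rfl fun k _ => key k]
  by_cases ha : a = j
  · subst ha
    by_cases hb : b = a
    · subst hb
      simp [symVar_comm b i]
      have h2 : (C 2 : MvPolynomial (SymIndex m) ℝ) = 2 := map_ofNat C 2
      rw [h2, two_mul]
    · simp [hb, Ne.symm hb]
  · by_cases hb : b = j
    · subst hb
      simp [ha, Ne.symm ha, symVar_comm a i]
    · simp [ha, hb, Ne.symm ha, Ne.symm hb]

/-- Differentiating column by column yields two contributions; the one that changes row indices is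
regrouped by rows through `sum_det_updateCol`. -/
theorem symPol_minor {k : ℕ} (i j : Fin m) (r c : Fin k → Fin m) :
    symPol i j ((symVar m).submatrix r c).det =
      ∑ p, (if r p = j then ((symVar m).submatrix (Function.update r p i) c).det else 0) +
      ∑ q, (if c q = j then ((symVar m).submatrix r (Function.update c q i)).det else 0) := by
  set M := (symVar m).submatrix r c with hM
  have h1 : ∀ q, (M.updateCol q fun p => symPol i j (M p q)).det =
      (M.updateCol q fun p => if r p = j then symVar m i (c q) else 0).det +
      (M.updateCol q fun p => if c q = j then symVar m (r p) i else 0).det := by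
    intro q
    rw [← Matrix.det_updateCol_add]
    congr 2
    funext p
    exact symPol_symVar i j (r p) (c q)
  rw [derivation_det, Finset.sum_congr rfl fun q _ => h1 q, Finset.sum_add_distrib]
  congr 1
  · rw [sum_det_updateCol M fun p q => if r p = j then symVar m i (c q) else 0]
    refine Finset.sum_congr rfl fun p _ => ?_
    split_ifs with h
    · congr 1
      ext a b
      by_cases ha : a = p
      · subst ha; simp
      · simp [hM, ha]
    · exact Matrix.det_eq_zero_of_row_eq_zero p fun b => by simp
  · refine Finset.sum_congr rfl fun q _ => ?_
    split_ifs with h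
    · congr 1
      ext a b
      by_cases hb : b = q
      · subst hb; simp
      · simp [hM, hb]
    · exact Matrix.det_eq_zero_of_column_eq_zero q fun b => by simp

theorem minor_isWeightedHomogeneous {k : ℕ} (r c : Fin k → Fin m) :
    IsWeightedHomogeneous symWeight ((symVar m).submatrix r c).det
      (∑ p, (Pi.single (r p) 1 + Pi.single (c p) 1)) := by
  rw [Matrix.det_apply]
  refine IsWeightedHomogeneous.sum _ _ _ fun σ _ => ?_
  have h := IsWeightedHomogeneous.prod Finset.univ
    (fun p => (symVar m).submatrix r c (σ p) p) _ fun p _ =>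
      symVar_isWeightedHomogeneous (r (σ p)) (c p)
  rw [Finset.sum_add_distrib, Equiv.sum_comp σ fun p => (Pi.single (r p) 1 : Fin m → ℕ),
    ← Finset.sum_add_distrib] at h
  rw [Units.smul_def]
  exact (weightedHomogeneousSubmodule ℝ symWeight _).toAddSubgroup.zsmul_mem h _

/-! ### The ideal of minors -/

/-- Sorting injective index maps changes the determinant only by signs; a repeated index makes it
zero. -/
theorem minor_mem_minorIdeal {k : ℕ} (r c : Fin k → Fin m) :
    ((symVar m).submatrix r c).det ∈ minorIdeal m k := by
  by_cases hr : Function.Injective r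
  · by_cases hc : Function.Injective c
    · let r' : Fin k ↪o Fin m := OrderEmbedding.ofStrictMono _
        ((Tuple.monotone_sort r).strictMono_of_injective (hr.comp (Tuple.sort r).injective))
      let c' : Fin k ↪o Fin m := OrderEmbedding.ofStrictMono _
        ((Tuple.monotone_sort c).strictMono_of_injective (hc.comp (Tuple.sort c).injective))
      have h : (symVar m).submatrix r c =
          (((symVar m).submatrix r' c').submatrix (Tuple.sort r).symm id).submatrix id
            (Tuple.sort c).symm := by
        ext a b
        simp [r', c']
      rw [h, Matrix.det_permute', Matrix.det_permute]
      exact Ideal.mul_mem_left _ _ (Ideal.mul_mem_left _ _ (Ideal.subset_span ⟨r', c', rfl⟩))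
    · simp only [Function.Injective, not_forall] at hc
      obtain ⟨a, b, h, hab⟩ := hc
      rw [Matrix.det_zero_of_column_eq hab fun i => by simp [h]]
      exact zero_mem _
  · simp only [Function.Injective, not_forall] at hr
    obtain ⟨a, b, h, hab⟩ := hr
    rw [Matrix.det_zero_of_row_eq hab (by ext; simp [h])]
    exact zero_mem _

theorem minor_mem_minorIdeal_of_le {k l : ℕ} (hkl : k ≤ l) (r c : Fin l → Fin m) :
    ((symVar m).submatrix r c).det ∈ minorIdeal m k := by
  induction l, hkl using Nat.le_induction with
  | base => exact minor_mem_minorIdeal r c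
  | succ l hl ih =>
    rw [Matrix.det_succ_row_zero]
    refine sum_mem fun j _ => Ideal.mul_mem_left _ _ ?_
    exact ih (r ∘ Fin.succ) (c ∘ j.succAbove)

theorem symPol_mem_minorIdeal {k : ℕ} (i j : Fin m) {p : MvPolynomial (SymIndex m) ℝ}
    (hp : p ∈ minorIdeal m k) : symPol i j p ∈ minorIdeal m k := by
  induction hp using Submodule.span_induction with
  | mem p h =>
    obtain ⟨r, c, rfl⟩ := h
    rw [symPol_minor]
    refine add_mem (sum_mem fun p _ => ?_) (sum_mem fun p _ => ?_) <;> split_ifs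
    · exact minor_mem_minorIdeal _ _
    · exact zero_mem _
    · exact minor_mem_minorIdeal _ _
    · exact zero_mem _
  | zero => simp
  | add p q _ _ hp hq => rw [map_add]; exact add_mem hp hq
  | smul a p h hp =>
    rw [smul_eq_mul, Derivation.leibniz]
    exact add_mem (Ideal.mul_mem_left _ _ hp) (Ideal.mul_mem_right _ _ h)

theorem weightedHomogeneousComponent_mem_minorIdeal {k : ℕ} (μ : Fin m → ℕ)
    {p : MvPolynomial (SymIndex m) ℝ} (hp : p ∈ minorIdeal m k) :
    weightedHomogeneousComponent symWeight μ p ∈ minorIdeal m k := by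
  let _ := weightedGradedAlgebra ℝ (symWeight (m := m))
  refine weightedHomogeneousComponent_mem_of_mem ℝ symWeight ?_ hp μ
  refine Ideal.homogeneous_span _ _ ?_
  rintro _ ⟨r, c, rfl⟩
  exact ⟨_, minor_isWeightedHomogeneous r c⟩

/-- The action of permutations of the indices on symmetric variables. -/
def symPerm (τ : Equiv.Perm (Fin m)) (s : SymIndex m) : SymIndex m := symIdx (τ s.1.1) (τ s.1.2)

theorem rename_symPerm_symVar (τ : Equiv.Perm (Fin m)) (a b : Fin m) :
    rename (symPerm τ) (symVar m a b) = symVar m (τ a) (τ b) := by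
  rw [symVar_apply, rename_X, symVar_apply]
  congr 1
  rcases le_total a b with h | h
  · simp [symPerm, symIdx, h]
  · simp [symPerm, symIdx, h, min_comm (τ b), max_comm (τ b)]

theorem rename_symPerm_mem_minorIdeal {k : ℕ} (τ : Equiv.Perm (Fin m))
    {p : MvPolynomial (SymIndex m) ℝ} (hp : p ∈ minorIdeal m k) :
    rename (symPerm τ) p ∈ minorIdeal m k := by
  suffices minorIdeal m k ≤ (minorIdeal m k).comap (rename (R := ℝ) (symPerm τ)) from this hp
  refine Ideal.span_le.2 ?_
  rintro _ ⟨r, c, rfl⟩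
  rw [SetLike.mem_coe, Ideal.mem_comap, AlgHom.map_det]
  convert minor_mem_minorIdeal (τ ∘ r) (τ ∘ c)
  ext1 a b
  exact rename_symPerm_symVar τ _ _

theorem rename_symPerm_swap_swap (i j : Fin m) (p : MvPolynomial (SymIndex m) ℝ) :
    rename (symPerm (Equiv.swap i j)) (rename (symPerm (Equiv.swap i j)) p) = p := by
  rw [← AlgHom.comp_apply]
  conv_rhs => rw [← AlgHom.id_apply (R := ℝ) p]
  congr 1
  ext1 s
  simp only [AlgHom.comp_apply, X_eq_symVar, rename_symPerm_symVar, Equiv.swap_apply_self]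
  rfl

theorem single_comp_swap (i j a : Fin m) :
    (Pi.single a 1 : Fin m → ℕ) ∘ Equiv.swap i j = Pi.single (Equiv.swap i j a) 1 := by
  funext l
  simp only [Function.comp_apply, Pi.single_apply, Equiv.swap_apply_eq_iff]

theorem weight_comp_swap {σ : Type*} (wt : σ → Fin m → ℕ) (f : σ → σ) (i j : Fin m)
    (hf : ∀ s, wt (f s) = wt s ∘ Equiv.swap i j) {p : MvPolynomial σ ℝ} {μ : Fin m → ℕ}
    (hp : IsWeightedHomogeneous wt p μ) :
    IsWeightedHomogeneous wt (rename f p) (μ ∘ Equiv.swap i j) := by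
  have h : IsWeightedHomogeneous (fun s => wt s ∘ Equiv.swap i j) p (μ ∘ Equiv.swap i j) := by
    intro d hd
    rw [← hp hd]
    funext l
    simp [Finsupp.weight_apply, Finsupp.sum, Finset.sum_apply]
  refine IsWeightedHomogeneous.algHom (rename f) (fun s => ?_) h
  rw [rename_X, ← hf]
  exact isWeightedHomogeneous_X ℝ _ _

theorem symWeight_symPerm_swap (i j : Fin m) (s : SymIndex m) :
    symWeight (symPerm (Equiv.swap i j) s) = symWeight s ∘ Equiv.swap i j := by
  rw [symPerm, symWeight_symIdx, symWeight, ← single_comp_swap, ← single_comp_swap]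
  rfl

end SymVar

end

end OrthogonalInvariants

namespace OrthogonalInvariants

noncomputable section

open MvPolynomial

/-! ### Polynomials in the coordinates of `m` vectors -/

section Vectors

variable {m N : ℕ}

/-- The weight of a coordinate of the `i`-th vector. -/
def vecWeight (s : Fin m × Fin N) : Fin m → ℕ := Pi.single s.1 1

/-- The polarization operators on polynomials in the coordinates of `m` vectors. -/
def vecPol (i j : Fin m) :
    Derivation ℝ (MvPolynomial (Fin m × Fin N) ℝ) (MvPolynomial (Fin m × Fin N) ℝ) :=
  polarization (fun i a => (i, a)) (fun _ => 1) i j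

theorem vecPol_X (i j b : Fin m) (a : Fin N) :
    vecPol i j (X (b, a)) = if b = j then X (i, a) else 0 := by
  classical
  rw [vecPol, polarization_apply, Finset.sum_eq_single a]
  · by_cases h : b = j
    · subst h; simp
    · simp [pderiv_X, h]
  · intro k _ hk
    simp [pderiv_X, Ne.symm hk]
  · simp

theorem weight_comp_swap_vec (i j : Fin m) {p : MvPolynomial (Fin m × Fin N) ℝ} {μ : Fin m → ℕ}
    (hp : IsWeightedHomogeneous vecWeight p μ) :
    IsWeightedHomogeneous vecWeight (rename (Prod.map (Equiv.swap i j) id) p)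
      (μ ∘ Equiv.swap i j) :=
  weight_comp_swap _ _ i j (fun s => (single_comp_swap i j s.1).symm) hp

theorem rename_swap_swap (i j : Fin m) (p : MvPolynomial (Fin m × Fin N) ℝ) :
    rename (Prod.map (Equiv.swap i j) id) (rename (Prod.map (Equiv.swap i j) id) p) = p := by
  rw [rename_rename, Prod.map_comp_map]
  have : (Equiv.swap i j : Fin m → Fin m) ∘ Equiv.swap i j = id := by
    funext l; simp
  simp [this]

/-- The diagonal bilinear form with coefficients `ε`. -/
def diagForm (ε : Fin N → ℝ) : LinearMap.BilinForm ℝ (Fin N → ℝ) :=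
  LinearMap.mk₂ ℝ (fun u v => ∑ a, ε a * u a * v a)
    (fun u u' v => by simp [mul_add, add_mul, Finset.sum_add_distrib])
    (fun c u v => by simp [Finset.mul_sum]; congr; funext; ring)
    (fun u v v' => by simp [mul_add, Finset.sum_add_distrib])
    (fun c u v => by simp [Finset.mul_sum]; congr; funext; ring)

theorem diagForm_apply (ε : Fin N → ℝ) (u v : Fin N → ℝ) :
    diagForm ε u v = ∑ a, ε a * u a * v a := rfl

theorem diagForm_comm (ε : Fin N → ℝ) (u v : Fin N → ℝ) : diagForm ε u v = diagForm ε v u := by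
  rw [diagForm_apply, diagForm_apply]
  exact Finset.sum_congr rfl fun _ _ => mul_right_comm _ _ _

/-- The homomorphism which sends the symmetric variables to the entries of the Gram matrix. -/
def gramHom (ε : Fin N → ℝ) :
    MvPolynomial (SymIndex m) ℝ →ₐ[ℝ] MvPolynomial (Fin m × Fin N) ℝ :=
  aeval fun s => ∑ a, C (ε a) * (X (s.1.1, a) * X (s.1.2, a))

theorem gramHom_symVar (ε : Fin N → ℝ) (i j : Fin m) :
    gramHom ε (symVar m i j) = ∑ a, C (ε a) * (X (i, a) * X (j, a)) := by
  rw [gramHom, symVar_apply, aeval_X]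
  rcases le_total i j with h | h
  · simp [symIdx, h]
  · simp [symIdx, h, mul_comm (X (i, _))]

theorem eval_gramHom (ε : Fin N → ℝ) (x : Fin m → Fin N → ℝ) (p : MvPolynomial (SymIndex m) ℝ) :
    eval (Function.uncurry x) (gramHom ε p) =
      eval (fun s : SymIndex m => diagForm ε (x s.1.1) (x s.1.2)) p := by
  induction p using MvPolynomial.induction_on with
  | C a => simp [← algebraMap_eq]
  | add p q hp hq => simp [hp, hq]
  | mul_X p s hp =>
    rw [map_mul, map_mul, hp, map_mul, eval_X]
    simp [gramHom, diagForm_apply, mul_assoc]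

theorem gramHom_symPol (ε : Fin N → ℝ) (i j : Fin m) (p : MvPolynomial (SymIndex m) ℝ) :
    gramHom ε (symPol i j p) = vecPol i j (gramHom ε p) := by
  refine algHom_derivation_comm _ _ _ (fun s => ?_) p
  rw [X_eq_symVar, symPol_symVar, gramHom_symVar, map_add, map_sum]
  have : ∀ a, vecPol i j (C (ε a) * (X (s.1.1, a) * X (s.1.2, a))) =
      (if s.1.1 = j then C (ε a) * (X (i, a) * X (s.1.2, a)) else 0) +
      (if s.1.2 = j then C (ε a) * (X (s.1.1, a) * X (i, a)) else 0) := by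
    intro a
    rw [C_mul', Derivation.map_smul, Derivation.leibniz, vecPol_X, vecPol_X, smul_add, add_comm]
    congr 1 <;> split_ifs <;> simp [smul_eq_C_mul, mul_comm (X (i, a))]
  rw [Finset.sum_congr rfl fun a _ => this a, Finset.sum_add_distrib]
  congr 1 <;> split_ifs <;> simp [gramHom_symVar]

theorem gramHom_rename (ε : Fin N → ℝ) (τ : Equiv.Perm (Fin m))
    (p : MvPolynomial (SymIndex m) ℝ) :
    gramHom ε (rename (symPerm τ) p) = rename (Prod.map τ id) (gramHom ε p) := by
  rw [← AlgHom.comp_apply, ← AlgHom.comp_apply (rename _)]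
  congr 1
  ext1 s
  simp [AlgHom.comp_apply, X_eq_symVar, rename_symPerm_symVar, gramHom_symVar]

theorem gramHom_X_weight (ε : Fin N → ℝ) (s : SymIndex m) :
    IsWeightedHomogeneous vecWeight (gramHom ε (X s)) (symWeight s) := by
  rw [X_eq_symVar, gramHom_symVar]
  exact IsWeightedHomogeneous.sum _ _ _ fun a _ => IsWeightedHomogeneous.C_mul
    ((isWeightedHomogeneous_X ℝ vecWeight _).mul (isWeightedHomogeneous_X ℝ vecWeight _)) _

/-- The substitution of a linear map in each of the vectors. -/
def linSubst (A : (Fin N → ℝ) →ₗ[ℝ] (Fin N → ℝ)) :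
    MvPolynomial (Fin m × Fin N) ℝ →ₐ[ℝ] MvPolynomial (Fin m × Fin N) ℝ :=
  aeval fun s => ∑ b, C (A (Pi.single b 1) s.2) * X (s.1, b)

theorem eval_linSubst (A : (Fin N → ℝ) →ₗ[ℝ] (Fin N → ℝ)) (x : Fin m → Fin N → ℝ)
    (p : MvPolynomial (Fin m × Fin N) ℝ) :
    eval (Function.uncurry x) (linSubst A p) = eval (Function.uncurry fun i => A (x i)) p := by
  induction p using MvPolynomial.induction_on with
  | C a => simp [← algebraMap_eq]
  | add p q hp hq => simp [hp, hq]
  | mul_X p s hp =>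
    rw [map_mul, map_mul, hp, map_mul, eval_X]
    congr 1
    have h1 : x s.1 = ∑ b, x s.1 b • (Pi.single b 1 : Fin N → ℝ) := by
      funext c; simp [Finset.sum_apply, Pi.single_apply]
    have h2 : A (x s.1) s.2 = ∑ b, x s.1 b * A (Pi.single b 1) s.2 := by
      conv_lhs => rw [h1]
      simp [map_sum, Finset.sum_apply]
    refine Eq.trans ?_ h2.symm
    simp [linSubst, mul_comm]

theorem linSubst_vecPol (A : (Fin N → ℝ) →ₗ[ℝ] (Fin N → ℝ)) (i j : Fin m)
    (p : MvPolynomial (Fin m × Fin N) ℝ) :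
    linSubst A (vecPol i j p) = vecPol i j (linSubst A p) := by
  refine algHom_derivation_comm _ _ _ (fun s => ?_) p
  obtain ⟨b, a⟩ := s
  simp only [vecPol_X, linSubst, aeval_X, map_sum, C_mul', Derivation.map_smul]
  split_ifs with h
  · simp
  · simp

theorem linSubst_rename (A : (Fin N → ℝ) →ₗ[ℝ] (Fin N → ℝ)) (τ : Equiv.Perm (Fin m))
    (p : MvPolynomial (Fin m × Fin N) ℝ) :
    linSubst A (rename (Prod.map τ id) p) = rename (Prod.map τ id) (linSubst A p) := by
  rw [← AlgHom.comp_apply, ← AlgHom.comp_apply (rename _)]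
  congr 1
  ext1 s
  simp [AlgHom.comp_apply, linSubst]

theorem linSubst_X_weight (A : (Fin N → ℝ) →ₗ[ℝ] (Fin N → ℝ)) (s : Fin m × Fin N) :
    IsWeightedHomogeneous vecWeight (linSubst A (X s)) (vecWeight s) := by
  rw [linSubst, aeval_X]
  exact IsWeightedHomogeneous.sum _ _ _ fun a _ => IsWeightedHomogeneous.C_mul
    (isWeightedHomogeneous_X ℝ vecWeight (s.1, a)) _

/-- The polynomials which are invariant under the isometries of the diagonal form. -/
def diagInvariants (m : ℕ) (ε : Fin N → ℝ) : Submodule ℝ (MvPolynomial (Fin m × Fin N) ℝ) :=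
  ⨅ A ∈ isometryGroup (diagForm ε),
    LinearMap.eqLocus (linSubst (A : (Fin N → ℝ) →ₗ[ℝ] _)).toLinearMap LinearMap.id

theorem mem_diagInvariants {ε : Fin N → ℝ} {p : MvPolynomial (Fin m × Fin N) ℝ} :
    p ∈ diagInvariants m ε ↔
      ∀ A ∈ isometryGroup (diagForm ε), linSubst (A : (Fin N → ℝ) →ₗ[ℝ] _) p = p := by
  simp [diagInvariants, Submodule.mem_iInf]

theorem mem_diagInvariants_iff_eval {ε : Fin N → ℝ} {p : MvPolynomial (Fin m × Fin N) ℝ} :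
    p ∈ diagInvariants m ε ↔ ∀ A ∈ isometryGroup (diagForm ε), ∀ x : Fin m → Fin N → ℝ,
      eval (Function.uncurry fun i => A (x i)) p = eval (Function.uncurry x) p := by
  rw [mem_diagInvariants]
  refine forall₂_congr fun A _ => ⟨fun h x => ?_, fun h => MvPolynomial.funext fun y => ?_⟩
  · conv_rhs => rw [← h, eval_linSubst]
    rfl
  · have := h (Function.curry y)
    rw [Function.uncurry_curry] at this
    rw [← this, ← Function.uncurry_curry y, eval_linSubst]
    rfl

theorem gramHom_mem_diagInvariants (ε : Fin N → ℝ) (p : MvPolynomial (SymIndex m) ℝ) :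
    gramHom ε p ∈ diagInvariants m ε := by
  rw [mem_diagInvariants_iff_eval]
  intro A hA x
  rw [eval_gramHom, eval_gramHom]
  congr 2
  funext s
  exact hA _ _

/-! ### Evaluation of highest weight vectors -/

/-- The integrated form of having weight μ: the action of the diagonal torus. -/
theorem eval_smul_of_weight {p : MvPolynomial (Fin m × Fin N) ℝ} {μ : Fin m → ℕ}
    (hp : IsWeightedHomogeneous vecWeight p μ) (t : Fin m → ℝ) (x : Fin m → Fin N → ℝ) :
    eval (Function.uncurry fun i => t i • x i) p =
      (∏ i, t i ^ μ i) * eval (Function.uncurry x) p := by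
  induction hp using IsWeightedHomogeneous.induction_on with
  | zero => simp
  | add p q _ _ hp hq => rw [map_add, map_add, hp, hq, mul_add]
  | monomial α a hα =>
    rw [eval_monomial, eval_monomial, mul_left_comm]
    congr 1
    subst hα
    simp only [Finsupp.weight_apply, Finsupp.sum, Finsupp.prod, Finset.sum_apply, Pi.smul_apply,
      smul_eq_mul, ← Finset.prod_pow_eq_pow_sum]
    rw [Finset.prod_comm, ← Finset.prod_mul_distrib]
    refine Finset.prod_congr rfl fun s _ => ?_
    rw [Finset.prod_eq_single s.1]
    · simp [Function.uncurry_def, vecWeight, mul_pow]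
    · intro i _ hi
      simp [vecWeight, hi]
    · simp

/-- The integrated form of the highest weight condition. Along the line t ↦ x_j + t c_j x_i the
derivative of p is the value of ∑ c_j D_ij p, which is zero. That c i = 0 keeps x_i fixed along the
line. -/
theorem eval_add_smul_of_vecPol {p : MvPolynomial (Fin m × Fin N) ℝ} {i : Fin m}
    (hp : ∀ j, i < j → vecPol i j p = 0) {c : Fin m → ℝ} (hc : ∀ j, j ≤ i → c j = 0)
    (x : Fin m → Fin N → ℝ) :
    eval (Function.uncurry fun j => x j + c j • x i) p = eval (Function.uncurry x) p := by
  let θ : MvPolynomial (Fin m × Fin N) ℝ →ₐ[ℝ] Polynomial ℝ :=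
    aeval fun s => Polynomial.C (x s.1 s.2) + Polynomial.C (c s.1 * x i s.2) * Polynomial.X
  have hθ : ∀ t q, Polynomial.eval t (θ q) =
      eval (Function.uncurry fun j => x j + (c j * t) • x i) q := by
    intro t q
    induction q using MvPolynomial.induction_on with
    | C a => simp [← algebraMap_eq]
    | add p q hp hq => simp [hp, hq]
    | mul_X p s hp =>
      rw [map_mul, Polynomial.eval_mul, hp, map_mul, eval_X]
      simp [θ, Function.uncurry_def]
      left; ring
  have hD : ∀ q, Polynomial.derivative (θ q) = θ (∑ j, C (c j) * vecPol i j q) := by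
    intro q
    induction q using MvPolynomial.induction_on with
    | C a => simp [← algebraMap_eq]
    | add p q hp hq => simp [hp, hq, mul_add, Finset.sum_add_distrib]
    | mul_X p s hp =>
      have h1 : θ (∑ j, C (c j) * vecPol i j (X s)) = Polynomial.derivative (θ (X s)) := by
        obtain ⟨b, a⟩ := s
        simp only [vecPol_X, mul_ite, mul_zero, Finset.sum_ite_eq, Finset.mem_univ, if_true]
        simp [θ, hc i le_rfl, ← algebraMap_eq]
      rw [map_mul, Polynomial.derivative_mul, hp, ← h1, ← map_mul, ← map_mul, ← map_add]
      congr 1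
      simp only [Derivation.leibniz, smul_eq_mul, mul_add, Finset.sum_add_distrib,
        Finset.sum_mul, Finset.mul_sum]
      rw [add_comm]
      congr 1 <;> exact Finset.sum_congr rfl fun _ _ => by ring
  have h0 : Polynomial.derivative (θ p) = 0 := by
    rw [hD, Finset.sum_eq_zero, map_zero]
    intro j _
    rcases le_or_gt j i with h | h
    · rw [hc j h, C_0, zero_mul]
    · rw [hp j h, mul_zero]
  obtain ⟨r, hr⟩ := Polynomial.natDegree_eq_zero.1
    (Polynomial.derivative_eq_zero.1 h0)
  have h1 := hθ 1 p
  have h2 := hθ 0 p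
  rw [← hr, Polynomial.eval_C] at h1 h2
  simp only [mul_one, mul_zero, zero_smul, add_zero] at h1 h2
  rw [← h1, h2]

theorem exists_reflection (ε : Fin N → ℝ) {u : Fin N → ℝ} (hu : diagForm ε u u ≠ 0) :
    ∃ A ∈ isometryGroup (diagForm ε),
      ∀ v, A v = v - (2 * diagForm ε u v / diagForm ε u u) • u := by
  let f : Module.Dual ℝ (Fin N → ℝ) := (2 / diagForm ε u u) • diagForm ε u
  have hf : f u = 2 := by simp [f, hu]
  have hv : ∀ v, Module.reflection hf v = v - (2 * diagForm ε u v / diagForm ε u u) • u := by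
    intro v
    rw [Module.reflection_apply]
    simp only [f, LinearMap.smul_apply, smul_eq_mul]
    rw [div_mul_eq_mul_div]
  refine ⟨Module.reflection hf, fun v v' => ?_, hv⟩
  rw [hv, hv]
  simp only [map_sub, map_smul, LinearMap.sub_apply, LinearMap.smul_apply, smul_eq_mul,
    diagForm_comm ε v u]
  field_simp
  ring

end Vectors

end

end OrthogonalInvariants

namespace OrthogonalInvariants

noncomputable section

open MvPolynomial Filter Topology

/-! ### Uniqueness of invariant highest weight vectors -/

section Uniqueness

variable {m N : ℕ}

/-- The first `m` vectors of the sequence `b₀, …, b_{N-1}, 0, 0, …` formed by the standard basis. -/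
def stdFrame (m N : ℕ) : Fin m → Fin N → ℝ := fun i a => if (i : ℕ) = a then 1 else 0

theorem stdFrame_apply (i : Fin m) (a : Fin N) :
    stdFrame m N i a = if (i : ℕ) = a then 1 else 0 := rfl

theorem diagForm_stdFrame (ε : Fin N → ℝ) {i : Fin m} {a : Fin N} (h : (i : ℕ) = a)
    (v : Fin N → ℝ) : diagForm ε (stdFrame m N i) v = ε a * v a := by
  rw [diagForm_apply, Finset.sum_eq_single a]
  · simp [stdFrame_apply, h]
  · intro b _ hb
    have : ¬ (i : ℕ) = b := fun h' => hb (Fin.ext (h'.symm.trans h))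
    simp [stdFrame_apply, this]
  · simp

theorem continuous_diagForm (ε : Fin N → ℝ) :
    Continuous fun p : (Fin N → ℝ) × (Fin N → ℝ) => diagForm ε p.1 p.2 := by
  simp only [diagForm_apply]
  fun_prop

theorem continuousAt_diagForm {α : Type*} [TopologicalSpace α] (ε : Fin N → ℝ)
    {f g : α → Fin N → ℝ} {x : α} (hf : ContinuousAt f x) (hg : ContinuousAt g x) :
    ContinuousAt (fun y => diagForm ε (f y) (g y)) x :=
  (continuous_diagForm ε).continuousAt.comp (hf.prodMk hg)

theorem continuousAt_vec (x : Fin m → Fin N → ℝ) (j : Fin m) :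
    ContinuousAt (fun y : Fin m → Fin N → ℝ => y j) x :=
  (continuous_apply j).continuousAt

/-- The frame `x` agrees with the standard frame in its first `k` rows and columns. -/
def AgreesUpTo (k : ℕ) (x : Fin m → Fin N → ℝ) : Prop :=
  ∀ (j : Fin m) (a : Fin N), ((j : ℕ) < k ∨ (a : ℕ) < k) → x j a = stdFrame m N j a

/-- The normalization of the `i`-th vector. -/
def normalizeVec (ε : Fin N → ℝ) (i : Fin m) (a : Fin N) (x : Fin m → Fin N → ℝ) :
    Fin m → Fin N → ℝ :=
  fun j => (if j = i then (√(ε a * diagForm ε (x i) (x i)))⁻¹ else 1) • x j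

/-- The reflection which sends the `i`-th vector `v` to `-b`, if `v` and the `i`-th vector `b` of
the standard frame have the same length. -/
def reflectVec (ε : Fin N → ℝ) (i : Fin m) (x : Fin m → Fin N → ℝ) : Fin m → Fin N → ℝ :=
  fun j => x j - (2 * diagForm ε (x i + stdFrame m N i) (x j) /
    diagForm ε (x i + stdFrame m N i) (x i + stdFrame m N i)) • (x i + stdFrame m N i)

/-- The change of sign of the `i`-th vector. -/
def negVec (i : Fin m) (x : Fin m → Fin N → ℝ) : Fin m → Fin N → ℝ :=
  fun j => (if j = i then -1 else 1 : ℝ) • x j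

/-- Subtraction of multiples of the `i`-th vector from the later ones. -/
def clearVec (i : Fin m) (a : Fin N) (x : Fin m → Fin N → ℝ) : Fin m → Fin N → ℝ :=
  fun j => x j + (if i < j then -x j a else 0) • x i

/-! ### One Gram–Schmidt step near the standard frame -/

section Step

variable {ε : Fin N → ℝ} (hε : ∀ a, ε a = -1 ∨ ε a = 1) {i : Fin m} {a : Fin N}
  (hia : (i : ℕ) = a)

include hε hia

theorem tendsto_normalizeVec :
    Tendsto (normalizeVec ε i a) (𝓝 (stdFrame m N)) (𝓝 (stdFrame m N)) := by
  have h2 : ε a * diagForm ε (stdFrame m N i) (stdFrame m N i) = 1 := by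
    rw [diagForm_stdFrame ε hia, stdFrame_apply, if_pos hia]
    rcases hε a with h | h <;> simp [h]
  have h1 : normalizeVec ε i a (stdFrame m N) = stdFrame m N := by
    funext j
    simp [normalizeVec, h2]
  have h3 : ContinuousAt (normalizeVec ε i a) (stdFrame m N) := by
    refine continuousAt_pi.2 fun j => ?_
    unfold normalizeVec
    split_ifs
    · refine ContinuousAt.smul (ContinuousAt.inv₀ (ContinuousAt.sqrt
        (continuousAt_const.mul (continuousAt_diagForm ε (continuousAt_vec _ i)
          (continuousAt_vec _ i)))) ?_) (continuousAt_vec _ j)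
      simp [h2]
    · simpa using continuousAt_vec (stdFrame m N) j
  simpa only [h1] using h3.tendsto

/-- With b the i-th frame vector, the reflection along v + b sends v to -b when v and b have equal
length, and is still defined at v = b. The one along v - b would send v to b directly but
degenerates there, hence the later sign change. -/
theorem diagForm_add_stdFrame_ne_zero :
    diagForm ε (stdFrame m N i + stdFrame m N i) (stdFrame m N i + stdFrame m N i) ≠ 0 := by
  simp only [map_add, LinearMap.add_apply, diagForm_stdFrame ε hia]
  simp only [stdFrame_apply, if_pos hia]
  rcases hε a with h | h <;> simp [h]

theorem tendsto_negVec_reflectVec :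
    Tendsto (fun x => negVec i (reflectVec ε i x)) (𝓝 (stdFrame m N)) (𝓝 (stdFrame m N)) := by
  have h0 := diagForm_add_stdFrame_ne_zero hε hia
  have h1 : negVec i (reflectVec ε i (stdFrame m N)) = stdFrame m N := by
    have h4 : ε a ≠ 0 := by rcases hε a with h | h <;> simp [h]
    funext j b
    by_cases hj : j = i
    · subst hj
      simp only [negVec, reflectVec, map_add, LinearMap.add_apply, diagForm_stdFrame ε hia]
      simp only [stdFrame_apply, if_pos hia]
      have : (2 : ℝ) * (ε a * 1 + ε a * 1) / (ε a * 1 + ε a * 1 + (ε a * 1 + ε a * 1)) = 1 := by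
        field_simp; norm_num
      rw [this]
      split_ifs <;> simp_all [stdFrame_apply]
    · have : ¬ (j : ℕ) = a := fun h => hj (Fin.ext (h.trans hia.symm))
      simp only [negVec, reflectVec, map_add, LinearMap.add_apply, diagForm_stdFrame ε hia]
      simp [hj, stdFrame_apply, this]
  have h3 : ContinuousAt (fun x => negVec i (reflectVec ε i x)) (stdFrame m N) := by
    refine continuousAt_pi.2 fun j => ?_
    unfold negVec reflectVec
    have hu := (continuousAt_vec (stdFrame m N) i).add_const (stdFrame m N i)
    have hj := continuousAt_vec (stdFrame m N) j
    refine ContinuousAt.smul (f := fun _ => if j = i then (-1 : ℝ) else 1) continuousAt_const ?_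
    exact hj.sub (((continuousAt_const.mul (continuousAt_diagForm ε hu hj)).div
      (continuousAt_diagForm ε hu hu) h0).smul hu)
  simpa only [h1] using h3.tendsto

omit hε in
theorem tendsto_clearVec :
    Tendsto (clearVec i a) (𝓝 (stdFrame m N)) (𝓝 (stdFrame m N)) := by
  have h1 : clearVec i a (stdFrame m N) = stdFrame m N := by
    funext j
    unfold clearVec
    split_ifs with h
    · have : ¬ (j : ℕ) = a := fun h' => h.ne (Fin.ext (hia.trans h'.symm))
      simp [stdFrame_apply, this]
    · simp
  have h3 : ContinuousAt (clearVec i a) (stdFrame m N) := by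
    refine continuousAt_pi.2 fun j => ?_
    have hj := continuousAt_vec (stdFrame m N) j
    have hi := continuousAt_vec (stdFrame m N) i
    unfold clearVec
    split_ifs
    · exact hj.add ((((continuous_apply a).continuousAt.comp hj).neg).smul hi)
    · simpa using hj
  simpa only [h1] using h3.tendsto

/-- One step of the reduction to the standard frame. -/
theorem agreesUpTo_succ {x : Fin m → Fin N → ℝ} (hx : AgreesUpTo a x)
    (hpos : 0 < ε a * diagForm ε (x i) (x i))
    (hne : diagForm ε (normalizeVec ε i a x i + stdFrame m N i)
      (normalizeVec ε i a x i + stdFrame m N i) ≠ 0) :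
    AgreesUpTo (a + 1) (clearVec i a (negVec i (reflectVec ε i (normalizeVec ε i a x)))) := by
  set y := normalizeVec ε i a x with hy
  have hya : AgreesUpTo a y := by
    intro j b hjb
    by_cases hj : j = i
    · subst hj
      have hb : (b : ℕ) < a := hjb.resolve_left (by omega)
      have : ¬ (j : ℕ) = b := by omega
      simp [hy, normalizeVec, hx j b hjb, stdFrame_apply, this]
    · simp [hy, normalizeVec, hx j b hjb, hj]
  have hε2 : ε a * ε a = 1 := by rcases hε a with h | h <;> simp [h]
  have hyi : diagForm ε (y i) (y i) = ε a := by
    have h1 : y i = (√(ε a * diagForm ε (x i) (x i)))⁻¹ • x i := by simp [hy, normalizeVec]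
    have h2 := Real.mul_self_sqrt hpos.le
    have h3 : √(ε a * diagForm ε (x i) (x i)) ≠ 0 := (Real.sqrt_pos.2 hpos).ne'
    rw [h1, map_smul, map_smul, LinearMap.smul_apply, smul_eq_mul, smul_eq_mul]
    field_simp
    rw [pow_two, h2, ← mul_assoc, hε2, one_mul]
  -- The mirror vector u vanishes in the earlier columns and is orthogonal to the earlier vectors,
  -- so the reflection preserves the rows and columns already normalized.
  set u := y i + stdFrame m N i with hu
  have huy : 2 * diagForm ε u (y i) / diagForm ε u u = 1 := by
    rw [div_eq_one_iff_eq hne]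
    simp only [hu, map_add, LinearMap.add_apply, hyi, diagForm_comm ε (y i) (stdFrame m N i),
      diagForm_stdFrame ε hia]
    simp only [stdFrame_apply, if_pos hia]
    ring
  have hub : ∀ b : Fin N, (b : ℕ) < a → u b = 0 := by
    intro b hb
    have : ¬ (i : ℕ) = b := by omega
    simp [hu, hya i b (Or.inr hb), stdFrame_apply, this]
  have huj : ∀ j : Fin m, (j : ℕ) < a → diagForm ε u (y j) = 0 := by
    intro j hj
    rw [diagForm_apply]
    refine Finset.sum_eq_zero fun b _ => ?_
    rw [hya j b (Or.inl hj), stdFrame_apply]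
    split_ifs with h
    · rw [hub b (by omega), mul_zero, zero_mul]
    · rw [mul_zero]
  set z := negVec i (reflectVec ε i y) with hz
  have hzi : z i = stdFrame m N i := by
    have : z i = -(y i - (2 * diagForm ε u (y i) / diagForm ε u u) • u) := by
      simp [hz, negVec, reflectVec, hu]
    rw [this, huy, one_smul, hu]
    abel
  have hzj : ∀ j, j ≠ i → z j = y j - (2 * diagForm ε u (y j) / diagForm ε u u) • u := by
    intro j hj
    simp [hz, negVec, reflectVec, hu, hj]
  have hza : AgreesUpTo a z := by
    intro j b hjb
    by_cases hj : j = i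
    · rw [hj, hzi]
    · rw [hzj j hj, ← hya j b hjb]
      rcases hjb with h | h
      · rw [huj j h, mul_zero, zero_div, zero_smul, sub_zero]
      · rw [Pi.sub_apply, Pi.smul_apply, hub b h, smul_zero, sub_zero]
  intro j b hjb
  unfold clearVec
  -- In a later row, subtracting the multiple of the i-th vector, now a standard basis vector,
  -- clears column a and leaves the other columns alone.
  split_ifs with h
  · have hj : ¬ (j : ℕ) < a + 1 := by have : (i : ℕ) < j := h; omega
    have hb := hjb.resolve_left hj
    rw [hzi, Pi.add_apply, Pi.smul_apply, smul_eq_mul]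
    by_cases hba : b = a
    · subst hba
      have : ¬ (j : ℕ) = b := by omega
      simp [stdFrame_apply, hia, this]
    · have hb' : (b : ℕ) < a := by
        have : (b : ℕ) ≠ a := fun h => hba (Fin.ext h)
        omega
      have : ¬ (i : ℕ) = b := by omega
      rw [hza j b (Or.inr hb'), stdFrame_apply i b, if_neg this, mul_zero, add_zero]
  · rw [zero_smul, add_zero]
    by_cases hj : j = i
    · rw [hj, hzi]
    · have hj' : (j : ℕ) < a := by
        have h1 : (j : ℕ) ≠ i := fun h => hj (Fin.ext h)
        have h2 : ¬ (i : ℕ) < j := h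
        omega
      exact hza j b (Or.inl hj')

end Step

variable {ε : Fin N → ℝ} {f : MvPolynomial (Fin m × Fin N) ℝ} {μ : Fin m → ℕ}

/-- Each step changes the value of f by a nonzero factor at most, so vanishing can be pulled back.
Each step also tends to the standard frame there, so the open conditions needed for the next step
persist on a neighbourhood. -/
theorem exists_reduction (hε : ∀ a, ε a = -1 ∨ ε a = 1) (hinv : f ∈ diagInvariants m ε)
    (hwt : IsWeightedHomogeneous vecWeight f μ) (hpol : ∀ i j, i < j → vecPol i j f = 0) (k : ℕ) :
    ∃ T : (Fin m → Fin N → ℝ) → Fin m → Fin N → ℝ,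
      Tendsto T (𝓝 (stdFrame m N)) (𝓝 (stdFrame m N)) ∧
      ∀ᶠ x in 𝓝 (stdFrame m N), AgreesUpTo k (T x) ∧
        (eval (Function.uncurry (T x)) f = 0 → eval (Function.uncurry x) f = 0) := by
  induction k with
  | zero => exact ⟨id, tendsto_id, Eventually.of_forall fun x =>
      ⟨fun j a h => by omega, fun h => h⟩⟩
  | succ k ih =>
    obtain ⟨T, hT, hTx⟩ := ih
    by_cases hk : k < m ∧ k < N
    · obtain ⟨i, hi⟩ : ∃ i : Fin m, (i : ℕ) = k := ⟨⟨k, hk.1⟩, rfl⟩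
      obtain ⟨a, ha⟩ : ∃ a : Fin N, (a : ℕ) = k := ⟨⟨k, hk.2⟩, rfl⟩
      have hia : (i : ℕ) = a := hi.trans ha.symm
      have h1 := tendsto_normalizeVec (ε := ε) hε hia
      have h2 := tendsto_negVec_reflectVec (ε := ε) hε hia
      have h3 := tendsto_clearVec (m := m) (N := N) hia
      refine ⟨fun x => clearVec i a (negVec i (reflectVec ε i (normalizeVec ε i a (T x)))),
        h3.comp (h2.comp (h1.comp hT)), ?_⟩
      have e1 : ∀ᶠ x in 𝓝 (stdFrame m N), 0 < ε a * diagForm ε (T x i) (T x i) := by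
        have hc : ContinuousAt (fun x : Fin m → Fin N → ℝ => ε a * diagForm ε (x i) (x i))
            (stdFrame m N) :=
          continuousAt_const.mul
            (continuousAt_diagForm ε (continuousAt_vec _ i) (continuousAt_vec _ i))
        refine hT.eventually (hc.eventually (lt_mem_nhds ?_))
        beta_reduce
        rw [diagForm_stdFrame ε hia, stdFrame_apply, if_pos hia]
        rcases hε a with h | h <;> simp [h]
      have e2 : ∀ᶠ x in 𝓝 (stdFrame m N),
          diagForm ε (normalizeVec ε i a (T x) i + stdFrame m N i)
            (normalizeVec ε i a (T x) i + stdFrame m N i) ≠ 0 := by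
        have hc : ContinuousAt (fun x : Fin m → Fin N → ℝ =>
            diagForm ε (x i + stdFrame m N i) (x i + stdFrame m N i)) (stdFrame m N) :=
          continuousAt_diagForm ε ((continuousAt_vec _ i).add_const _)
            ((continuousAt_vec _ i).add_const _)
        exact (h1.comp hT).eventually (hc.eventually_ne (diagForm_add_stdFrame_ne_zero hε hia))
      filter_upwards [hTx, e1, e2] with x hx hx1 hx2
      obtain ⟨hx, hxf⟩ := hx
      refine ⟨?_, fun h => hxf ?_⟩
      · rw [← ha] at hx ⊢
        exact agreesUpTo_succ hε hia hx hx1 hx2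
      -- The four operations are undone from the last to the first: by the highest weight condition,
      -- by weight, by invariance under a reflection, and by weight again.
      · have s1 : eval (Function.uncurry (negVec i (reflectVec ε i
            (normalizeVec ε i a (T x))))) f = 0 := by
          rw [← h]
          exact (eval_add_smul_of_vecPol (fun j hj => hpol i j hj)
            (fun j hj => if_neg hj.not_gt) _).symm
        have s2 : eval (Function.uncurry (reflectVec ε i (normalizeVec ε i a (T x)))) f = 0 := by
          have := eval_smul_of_weight hwt (fun j => if j = i then -1 else 1)
            (reflectVec ε i (normalizeVec ε i a (T x)))
          rw [show (fun j => (if j = i then -1 else 1 : ℝ) •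
            reflectVec ε i (normalizeVec ε i a (T x)) j) = negVec i (reflectVec ε i
            (normalizeVec ε i a (T x))) from rfl, s1] at this
          refine (mul_eq_zero.1 this.symm).resolve_left (Finset.prod_ne_zero_iff.2 fun j _ => ?_)
          split_ifs <;> simp
        have s3 : eval (Function.uncurry (normalizeVec ε i a (T x))) f = 0 := by
          obtain ⟨A, hA, hAv⟩ := exists_reflection ε hx2
          rw [← mem_diagInvariants_iff_eval.1 hinv A hA, ← s2]
          congr 3
          funext j
          exact hAv _
        have := eval_smul_of_weight hwt
          (fun j => if j = i then (√(ε a * diagForm ε (T x i) (T x i)))⁻¹ else 1) (T x)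
        refine (mul_eq_zero.1 (this.symm.trans s3)).resolve_left
          (Finset.prod_ne_zero_iff.2 fun j _ => pow_ne_zero _ ?_)
        split_ifs
        · exact inv_ne_zero (Real.sqrt_pos.2 hx1).ne'
        · exact one_ne_zero
    -- Once k reaches m or N, all rows or all columns already agree.
    · refine ⟨T, hT, hTx.mono fun x hx => ⟨fun j a _ => hx.1 j a ?_, hx.2⟩⟩
      have := j.2; have := a.2
      omega

/-- A ball for the sup metric is a product of intervals, and a polynomial vanishing on a product of
infinite sets is zero. -/
theorem eq_zero_of_eventually_eval_eq_zero {x₀ : Fin m → Fin N → ℝ}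
    (h : ∀ᶠ x in 𝓝 x₀, eval (Function.uncurry x) f = 0) : f = 0 := by
  obtain ⟨δ, hδ, h⟩ := Metric.eventually_nhds_iff.1 h
  refine funext_set (fun s : Fin m × Fin N => Metric.ball (x₀ s.1 s.2) δ) (fun s => ?_)
    fun y hy => ?_
  · rw [Real.ball_eq_Ioo]
    exact Set.Ioo_infinite (by linarith)
  · rw [map_zero, ← Function.uncurry_curry y]
    refine h ((dist_pi_lt_iff hδ).2 fun i => (dist_pi_lt_iff hδ).2 fun a => ?_)
    exact hy (i, a) (Set.mem_univ _)

/-- An invariant highest weight vector which vanishes at the standard frame is zero. -/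
theorem eq_zero_of_eval_stdFrame (hε : ∀ a, ε a = -1 ∨ ε a = 1) (hinv : f ∈ diagInvariants m ε)
    (hwt : IsWeightedHomogeneous vecWeight f μ) (hpol : ∀ i j, i < j → vecPol i j f = 0)
    (h0 : eval (Function.uncurry (stdFrame m N)) f = 0) : f = 0 := by
  obtain ⟨T, -, hT⟩ := exists_reduction hε hinv hwt hpol m
  refine eq_zero_of_eventually_eval_eq_zero (x₀ := stdFrame m N) (hT.mono fun x hx => hx.2 ?_)
  have : T x = stdFrame m N := by
    funext j a
    exact hx.1 j a (Or.inl j.2)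
  rw [this, h0]

end Uniqueness

end

end OrthogonalInvariants

namespace OrthogonalInvariants

noncomputable section

open MvPolynomial

/-! ### Products of leading minors -/

section LeadingMinors

variable {m N : ℕ}

/-- The leading minor with `k + 1` rows and columns. -/
def leadMinor (k : Fin m) : MvPolynomial (SymIndex m) ℝ :=
  ((symVar m).submatrix (Fin.castLE k.2) (Fin.castLE k.2)).det

/-- The extension by zero of a sequence of length `m`. -/
def extendZero (κ : Fin m → ℕ) (l : ℕ) : ℕ := if h : l < m then κ ⟨l, h⟩ else 0

/-- The product of leading minors with weight `2 κ`. -/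
def leadProd (κ : Fin m → ℕ) : MvPolynomial (SymIndex m) ℝ :=
  ∏ k : Fin m, leadMinor k ^ (extendZero κ k - extendZero κ (k + 1))

theorem extendZero_val (κ : Fin m → ℕ) (i : Fin m) : extendZero κ i = κ i := by
  simp [extendZero]

theorem extendZero_antitone {κ : Fin m → ℕ} (hκ : Antitone κ) : Antitone (extendZero κ) := by
  intro a b hab
  unfold extendZero
  split_ifs with h1 h2
  · exact hκ hab
  · omega
  · exact Nat.zero_le _
  · exact le_rfl

/-- The index i occurs in the leading minors k ≥ i only, and their exponents telescope to κ i
because the sequence is extended by zero at m. -/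
theorem sum_extendZero_sub {κ : Fin m → ℕ} (hκ : Antitone κ) (i : Fin m) :
    ∑ k : Fin m, (if i ≤ k then extendZero κ k - extendZero κ (k + 1) else 0) = κ i := by
  have key : ∀ n, ∑ l ∈ Finset.range n,
      (if (i : ℕ) ≤ l then extendZero κ l - extendZero κ (l + 1) else 0) +
      extendZero κ (max i n) = extendZero κ i := by
    intro n
    induction n with
    | zero => simp
    | succ n ih =>
      rw [Finset.sum_range_succ]
      split_ifs with h
      · rw [max_eq_right h] at ih
        rw [max_eq_right (by omega)]
        have := extendZero_antitone hκ (Nat.le_succ n)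
        simp only [Nat.succ_eq_add_one] at this
        omega
      · rw [max_eq_left (by omega)] at ih ⊢
        simpa using ih
  have := key m
  rw [max_eq_right i.2.le, extendZero_val, extendZero, dif_neg (lt_irrefl m), add_zero] at this
  rw [← this, ← Fin.sum_univ_eq_sum_range
    (fun l => if (i : ℕ) ≤ l then extendZero κ l - extendZero κ (l + 1) else 0)]
  rfl

theorem leadMinor_isWeightedHomogeneous (k : Fin m) :
    IsWeightedHomogeneous symWeight (leadMinor k) (fun i => 2 * if i ≤ k then 1 else 0) := by
  convert minor_isWeightedHomogeneous (Fin.castLE k.2) (Fin.castLE k.2) using 1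
  · rfl
  funext i
  rw [Finset.sum_apply]
  have h2 : ∀ p : Fin (k + 1), (Pi.single (Fin.castLE k.2 p) 1 +
      Pi.single (Fin.castLE k.2 p) 1 : Fin m → ℕ) i =
      2 * if i = Fin.castLE k.2 p then 1 else 0 := fun p => by
    rw [← two_mul, Pi.mul_apply, Pi.single_apply]; rfl
  rw [Finset.sum_congr rfl fun p _ => h2 p, ← Finset.mul_sum]
  congr 1
  split_ifs with h
  · have hik : (i : ℕ) < k + 1 := Nat.lt_succ_of_le h
    rw [Finset.sum_eq_single ⟨i, hik⟩]
    · simp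
    · intro b _ hb
      rw [if_neg]
      rintro rfl
      exact hb rfl
    · simp
  · refine (Finset.sum_eq_zero fun b _ => if_neg ?_).symm
    rintro rfl
    exact h (Fin.le_def.2 (Nat.le_of_lt_succ b.2))

theorem leadProd_isWeightedHomogeneous {κ : Fin m → ℕ} (hκ : Antitone κ) :
    IsWeightedHomogeneous symWeight (leadProd κ) (fun i => 2 * κ i) := by
  have h := IsWeightedHomogeneous.prod Finset.univ
    (fun k : Fin m => leadMinor k ^ (extendZero κ k - extendZero κ (k + 1))) _ fun k _ =>
      (leadMinor_isWeightedHomogeneous k).pow _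
  convert h using 1
  · rfl
  funext i
  rw [Finset.sum_apply, ← sum_extendZero_sub hκ i, Finset.mul_sum]
  refine Finset.sum_congr rfl fun k _ => ?_
  rw [Pi.smul_apply]
  split_ifs <;> simp [mul_comm]

/-- A leading minor that contains the index j also contains i < j, so replacing j by i repeats a row
or a column. -/
theorem symPol_leadMinor {i j : Fin m} (hij : i < j) (k : Fin m) :
    symPol i j (leadMinor k) = 0 := by
  rw [leadMinor, symPol_minor]
  have hne : ∀ p : Fin (k + 1), Fin.castLE k.2 p = j →
      ∃ q, q ≠ p ∧ Fin.castLE k.2 q = i := by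
    rintro p rfl
    have h1 : (i : ℕ) < p := hij
    refine ⟨⟨i, by omega⟩, fun h => ?_, Fin.ext rfl⟩
    rw [← h] at h1
    exact lt_irrefl _ h1
  have h1 : ∀ p : Fin (k + 1), (if Fin.castLE k.2 p = j then ((symVar m).submatrix
      (Function.update (Fin.castLE k.2) p i) (Fin.castLE k.2)).det else 0) = 0 := by
    intro p
    split_ifs with h
    · obtain ⟨q, hqp, hq⟩ := hne p h
      exact Matrix.det_zero_of_row_eq hqp (by ext1; simp [hqp, hq])
    · rfl
  have h2 : ∀ p : Fin (k + 1), (if Fin.castLE k.2 p = j then ((symVar m).submatrix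
      (Fin.castLE k.2) (Function.update (Fin.castLE k.2) p i)).det else 0) = 0 := by
    intro p
    split_ifs with h
    · obtain ⟨q, hqp, hq⟩ := hne p h
      exact Matrix.det_zero_of_column_eq hqp fun _ => by simp [hqp, hq]
    · rfl
  rw [Finset.sum_congr rfl fun p _ => h1 p, Finset.sum_congr rfl fun p _ => h2 p]
  simp

theorem symPol_leadProd {i j : Fin m} (hij : i < j) (κ : Fin m → ℕ) :
    symPol i j (leadProd κ) = 0 := by
  classical
  rw [leadProd, derivation_prod]
  refine Finset.sum_eq_zero fun p hp => Finset.prod_eq_zero hp ?_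
  rw [Function.update_self, Derivation.leibniz_pow, symPol_leadMinor hij, smul_zero, smul_zero]

theorem eval_stdFrame_leadMinor_ne_zero {ε : Fin N → ℝ} (hε : ∀ a, ε a = -1 ∨ ε a = 1)
    {k : Fin m} (hk : (k : ℕ) < N) :
    eval (Function.uncurry (stdFrame m N)) (gramHom ε (leadMinor k)) ≠ 0 := by
  have h : eval (Function.uncurry (stdFrame m N)) (gramHom ε (leadMinor k)) =
      (Matrix.diagonal fun p : Fin (k + 1) => ε (Fin.castLE hk p)).det := by
    rw [leadMinor, AlgHom.map_det, RingHom.map_det]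
    congr 1
    ext p q
    have h1 : ((Fin.castLE k.2 p : Fin m) : ℕ) = (Fin.castLE hk p : Fin N) := rfl
    have h3 : eval (Function.uncurry (stdFrame m N))
        (gramHom ε (symVar m (Fin.castLE k.2 p) (Fin.castLE k.2 q))) =
        diagForm ε (stdFrame m N (Fin.castLE k.2 p)) (stdFrame m N (Fin.castLE k.2 q)) := by
      rw [gramHom_symVar, map_sum, diagForm_apply]
      refine Finset.sum_congr rfl fun a _ => ?_
      simp [mul_assoc]
    refine h3.trans ?_
    rw [diagForm_stdFrame ε h1, stdFrame_apply, Matrix.diagonal_apply]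
    by_cases hpq : p = q
    · subst hpq; simp
    · have : ¬ (q : ℕ) = p := fun h => hpq (Fin.ext h.symm)
      simp [hpq, this]
  rw [h, Matrix.det_diagonal, Finset.prod_ne_zero_iff]
  intro p _
  rcases hε (Fin.castLE hk p) with h | h <;> simp [h]

theorem eval_stdFrame_leadProd_ne_zero {ε : Fin N → ℝ} (hε : ∀ a, ε a = -1 ∨ ε a = 1)
    {κ : Fin m → ℕ} (hκ : ∀ i : Fin m, N ≤ i → κ i = 0) :
    eval (Function.uncurry (stdFrame m N)) (gramHom ε (leadProd κ)) ≠ 0 := by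
  rw [leadProd, map_prod, map_prod, Finset.prod_ne_zero_iff]
  intro k _
  rw [map_pow, map_pow]
  by_cases hk : (k : ℕ) < N
  · exact pow_ne_zero _ (eval_stdFrame_leadMinor_ne_zero hε hk)
  · rw [extendZero_val, hκ k (not_lt.1 hk), Nat.zero_sub, pow_zero]
    exact one_ne_zero

/-- If κ i ≠ 0, some leading minor with k ≥ i has positive exponent; its size k + 1 is at least n +
1, and Laplace expansion puts it in the ideal. -/
theorem leadProd_mem_minorIdeal {κ : Fin m → ℕ} (hκ : Antitone κ) {i : Fin m} (hi : κ i ≠ 0)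
    {n : ℕ} (hn : n ≤ i) : leadProd κ ∈ minorIdeal m (n + 1) := by
  rw [← sum_extendZero_sub hκ i] at hi
  obtain ⟨k, -, hk⟩ := Finset.exists_ne_zero_of_sum_ne_zero hi
  have hik : i ≤ k := by
    by_contra h
    exact hk (if_neg h)
  rw [if_pos hik] at hk
  rw [leadProd]
  refine Ideal.prod_mem (minorIdeal m (n + 1)) (Finset.mem_univ k)
    (Ideal.pow_mem_of_mem _ ?_ _ (Nat.pos_of_ne_zero hk))
  have : (i : ℕ) ≤ k := hik
  exact minor_mem_minorIdeal_of_le (by omega) _ _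

/-- Invariant highest weight vectors are products of leading minors of the Gram matrix. -/
theorem exists_eq_gramHom_leadProd {ε : Fin N → ℝ} (hε : ∀ a, ε a = -1 ∨ ε a = 1)
    {f : MvPolynomial (Fin m × Fin N) ℝ} {μ : Fin m → ℕ} (hμ : Antitone μ)
    (hinv : f ∈ diagInvariants m ε) (hwt : IsWeightedHomogeneous vecWeight f μ)
    (hpol : ∀ i j, i < j → vecPol i j f = 0) :
    ∃ κ : Fin m → ℕ, Antitone κ ∧ ∃ c : ℝ, f = gramHom ε (C c * leadProd κ) := by
  by_cases h0 : eval (Function.uncurry (stdFrame m N)) f = 0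
  · refine ⟨fun _ => 0, antitone_const, 0, ?_⟩
    rw [eq_zero_of_eval_stdFrame hε hinv hwt hpol h0]
    simp
  -- The i-th frame vector is zero for i ≥ N, so scaling it by 0 changes nothing, yet would multiply
  -- the value by 0 if μ i were positive.
  have hzero : ∀ i : Fin m, N ≤ i → μ i = 0 := by
    intro i hi
    by_contra hμi
    refine h0 ?_
    have h := eval_smul_of_weight hwt (fun j => if j = i then 0 else 1) (stdFrame m N)
    rw [Finset.prod_eq_zero (Finset.mem_univ i) (by simp [hμi]), zero_mul] at h
    rw [← h]
    congr 3
    funext j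
    split_ifs with hj
    · subst hj
      funext a
      have : ¬ (j : ℕ) = a := by omega
      simp [stdFrame_apply, this]
    · simp
  -- The reflection along the i-th frame vector negates that vector and fixes the others; comparing
  -- invariance with weight gives (-1) ^ μ i = 1.
  have heven : ∀ i : Fin m, Even (μ i) := by
    intro i
    by_cases hi : (i : ℕ) < N
    · obtain ⟨a, hia⟩ : ∃ a : Fin N, (i : ℕ) = a := ⟨⟨i, hi⟩, rfl⟩
      have hεa : ε a ≠ 0 := by rcases hε a with h | h <;> simp [h]
      have hne : diagForm ε (stdFrame m N i) (stdFrame m N i) ≠ 0 := by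
        rw [diagForm_stdFrame ε hia, stdFrame_apply, if_pos hia, mul_one]
        exact hεa
      obtain ⟨A, hA, hAv⟩ := exists_reflection ε hne
      have h1 := mem_diagInvariants_iff_eval.1 hinv A hA (stdFrame m N)
      have h2 := eval_smul_of_weight hwt (fun j => if j = i then -1 else 1) (stdFrame m N)
      have h3 : (fun j => A (stdFrame m N j)) =
          fun j => (if j = i then -1 else 1 : ℝ) • stdFrame m N j := by
        funext j
        rw [hAv, diagForm_stdFrame ε hia, diagForm_stdFrame ε hia]
        simp only [stdFrame_apply i a, if_pos hia]
        split_ifs with hj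
        · subst hj
          rw [stdFrame_apply j a, if_pos hia]
          field_simp
          module
        · have : ¬ (j : ℕ) = a := fun h => hj (Fin.ext (h.trans hia.symm))
          simp [stdFrame_apply j a, this]
      rw [h3, h2, Finset.prod_eq_single i (fun j _ hj => by simp [hj]) (by simp),
        if_pos rfl] at h1
      have h4 := mul_right_cancel₀ h0 (h1.trans (one_mul _).symm)
      exact neg_one_pow_eq_one_iff_even (by norm_num) |>.1 h4
    · rw [hzero i (not_lt.1 hi)]
      exact Even.zero
  have h2 : (fun i => 2 * (μ i / 2)) = μ := funext fun i => Nat.two_mul_div_two_of_even (heven i)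
  have hκ : Antitone fun i => μ i / 2 := fun i j hij => Nat.div_le_div_right (hμ hij)
  refine ⟨fun i => μ i / 2, hκ, ?_⟩
  set P := leadProd fun i => μ i / 2
  have hP := eval_stdFrame_leadProd_ne_zero (m := m) hε (κ := fun i => μ i / 2)
    fun i hi => by rw [hzero i hi]
  have hPwt : IsWeightedHomogeneous symWeight P μ := h2 ▸ leadProd_isWeightedHomogeneous hκ
  -- With this c, the difference of the two sides is again an invariant highest weight vector of
  -- weight μ, and it vanishes at the standard frame.
  let c := eval (Function.uncurry (stdFrame m N)) f /
    eval (Function.uncurry (stdFrame m N)) (gramHom ε P)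
  refine ⟨c, ?_⟩
  rw [← sub_eq_zero]
  refine eq_zero_of_eval_stdFrame (μ := μ) hε
    (Submodule.sub_mem _ hinv (gramHom_mem_diagInvariants ε _))
    (hwt.sub (IsWeightedHomogeneous.algHom _ (gramHom_X_weight ε) (hPwt.C_mul c)))
    (fun i j hij => ?_) ?_
  · rw [map_sub, hpol i j hij, ← gramHom_symPol, C_mul', Derivation.map_smul,
      symPol_leadProd hij, smul_zero, map_zero, sub_zero]
  · rw [map_sub, map_mul, map_mul, ← algebraMap_eq, AlgHom.commutes, algebraMap_eq, eval_C,
      div_mul_cancel₀ _ hP, sub_self]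

end LeadingMinors

/-! ### The fundamental theorems in coordinates -/

section Fundamental

variable {m N : ℕ}

theorem sum_vecWeight_ne_zero (s : Fin m × Fin N) : ∑ i, vecWeight s i ≠ 0 := by
  simp [vecWeight]

/-- The first fundamental theorem in coordinates. -/
theorem diagInvariants_le_range_gramHom {ε : Fin N → ℝ} (hε : ∀ a, ε a = -1 ∨ ε a = 1) :
    diagInvariants m ε ≤ LinearMap.range (gramHom (m := m) ε).toLinearMap := by
  -- Here K is the space of invariants and I the image of `gramHom`; the highest weight case is
  -- `exists_eq_gramHom_leadProd`.
  refine le_of_highestWeight_mem (v := fun i a => (i, a)) (w := fun _ => 1)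
    (fun _ => one_pos) (wt := vecWeight) (ρ := 0) (fun i k => (add_zero _).symm)
    sum_vecWeight_ne_zero ?_ ?_ ?_ ?_ ?_ (fun i j => rename (Prod.map (Equiv.swap i j) id))
    rename_swap_swap (fun i j p μ hp => weight_comp_swap_vec i j hp) ?_ ?_ ?_
  · rintro _ ⟨p, rfl⟩
    exact gramHom_mem_diagInvariants ε p
  · rintro i j _ ⟨p, rfl⟩
    exact ⟨symPol i j p, gramHom_symPol ε i j p⟩
  · intro i j p hp
    rw [mem_diagInvariants] at hp ⊢
    intro A hA
    exact (linSubst_vecPol _ i j p).trans (congrArg _ (hp A hA))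
  · rintro μ _ ⟨p, rfl⟩
    exact ⟨weightedHomogeneousComponent symWeight μ p,
      algHom_weightedHomogeneousComponent _ (gramHom_X_weight ε) μ p⟩
  · intro μ p hp
    rw [mem_diagInvariants] at hp ⊢
    intro A hA
    rw [algHom_weightedHomogeneousComponent _ (linSubst_X_weight _), hp A hA]
  · rintro i j _ ⟨p, rfl⟩
    exact ⟨rename (symPerm (Equiv.swap i j)) p, gramHom_rename ε _ p⟩
  · intro i j p hp
    rw [mem_diagInvariants] at hp ⊢
    intro A hA
    rw [linSubst_rename, hp A hA]
  · intro p hp μ hμ hwt hpol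
    obtain ⟨κ, -, c, rfl⟩ := exists_eq_gramHom_leadProd hε hμ hp hwt hpol
    exact ⟨_, rfl⟩

/-- The coefficients of a hyperbolic form on `ℝ ^ (m + m)`. -/
def hyperbolicCoeff (m : ℕ) : Fin (m + m) → ℝ := Fin.addCases (fun _ => 1) (fun _ => -1)

theorem hyperbolicCoeff_eq (m : ℕ) (a : Fin (m + m)) :
    hyperbolicCoeff m a = -1 ∨ hyperbolicCoeff m a = 1 := by
  induction a using Fin.addCases with
  | left a => exact Or.inr (Fin.addCases_left a)
  | right a => exact Or.inl (Fin.addCases_right a)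

/-- Every symmetric matrix S is the Gram matrix of m vectors, because (1 + S/4)² - (1 - S/4)² = S.
So a polynomial killed by the map vanishes at every point. -/
theorem gramHom_hyperbolicCoeff_injective (m : ℕ) :
    Function.Injective (gramHom (m := m) (hyperbolicCoeff m)) := by
  rw [injective_iff_map_eq_zero]
  intro p hp
  refine MvPolynomial.funext fun y => ?_
  let S : Matrix (Fin m) (Fin m) ℝ := fun i j => y (symIdx i j)
  have hS : S.transpose = S := by
    ext i j
    rw [Matrix.transpose_apply]
    simp only [S, symIdx, min_comm i j, max_comm i j]
  let x : Fin m → Fin (m + m) → ℝ := fun i =>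
    Fin.addCases (fun j => (1 + (4⁻¹ : ℝ) • S) i j) (fun j => (1 - (4⁻¹ : ℝ) • S) i j)
  have hx : ∀ i j, diagForm (hyperbolicCoeff m) (x i) (x j) = S i j := by
    intro i j
    rw [diagForm_apply, Fin.sum_univ_add]
    have h : (1 + (4⁻¹ : ℝ) • S) * (1 + (4⁻¹ : ℝ) • S).transpose -
        (1 - (4⁻¹ : ℝ) • S) * (1 - (4⁻¹ : ℝ) • S).transpose = S := by
      simp only [Matrix.transpose_add, Matrix.transpose_sub, Matrix.transpose_smul, hS,
        Matrix.transpose_one, mul_add, add_mul, mul_sub, sub_mul, mul_one, one_mul]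
      module
    conv_rhs => rw [← h]
    rw [Matrix.sub_apply, Matrix.mul_apply, Matrix.mul_apply, sub_eq_add_neg,
      ← Finset.sum_neg_distrib]
    simp only [x, hyperbolicCoeff, Fin.addCases_left, Fin.addCases_right, Matrix.transpose_apply,
      one_mul, neg_mul]
  have h := eval_gramHom (hyperbolicCoeff m) x p
  rw [hp, map_zero] at h
  rw [map_zero, h]
  congr 2
  funext s
  rw [hx]
  simp only [S, symIdx_val]

/-- Any N + 1 vectors of ℝ^N are dependent, which gives a linear relation between the rows of the
minor. -/
theorem minorIdeal_le_ker_gramHom (ε : Fin N → ℝ) :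
    minorIdeal m (N + 1) ≤ RingHom.ker (gramHom (m := m) ε) := by
  refine Ideal.span_le.2 ?_
  rintro _ ⟨r, c, rfl⟩
  rw [SetLike.mem_coe, RingHom.mem_ker]
  refine MvPolynomial.funext fun y => ?_
  let x := Function.curry y
  have hdep : ¬ LinearIndependent ℝ fun p => x (r p) := fun h => by
    simpa using h.fintype_card_le_finrank
  obtain ⟨v, hv, i, hi⟩ := Fintype.not_linearIndependent_iff.1 hdep
  rw [map_zero, AlgHom.map_det, RingHom.map_det]
  refine Matrix.exists_vecMul_eq_zero_iff.1 ⟨v, fun h => hi (congrFun h i), ?_⟩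
  funext q
  have h1 : ∀ p, eval y (gramHom ε (symVar m (r p) (c q))) = diagForm ε (x (r p)) (x (c q)) := by
    intro p
    rw [gramHom_symVar, map_sum, diagForm_apply]
    refine Finset.sum_congr rfl fun a _ => ?_
    simp [x, mul_assoc]
  have h2 : ∑ p, v p * diagForm ε (x (r p)) (x (c q)) = 0 := by
    have := congrArg (fun u => diagForm ε u (x (c q))) hv
    simpa [map_sum, LinearMap.sum_apply] using this
  rw [Pi.zero_apply, ← h2]
  simp only [Matrix.vecMul, dotProduct]
  exact Finset.sum_congr rfl fun p _ => congrArg (v p * ·) (h1 p)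

/-- The second fundamental theorem in coordinates. -/
theorem ker_gramHom {ε : Fin N → ℝ} (hε : ∀ a, ε a = -1 ∨ ε a = 1) :
    RingHom.ker (gramHom (m := m) ε) = minorIdeal m (N + 1) := by
  refine le_antisymm (fun p hp => ?_) (minorIdeal_le_ker_gramHom ε)
  suffices H : (RingHom.ker (gramHom (m := m) ε)).restrictScalars ℝ ≤
      (minorIdeal m (N + 1)).restrictScalars ℝ from H hp
  refine le_of_highestWeight_mem (v := symIdx) (wt := symWeight)
    symFischerWeight_pos (ρ := fun k => Pi.single k 1) symWeight_symIdx
    sum_symWeight_ne_zero (minorIdeal_le_ker_gramHom ε)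
    (fun i j p hp => symPol_mem_minorIdeal i j hp) ?_
    (fun μ p hp => weightedHomogeneousComponent_mem_minorIdeal μ hp) ?_
    (fun i j => rename (symPerm (Equiv.swap i j))) rename_symPerm_swap_swap
    (fun i j p μ hp => weight_comp_swap _ _ i j (symWeight_symPerm_swap i j) hp)
    (fun i j p hp => rename_symPerm_mem_minorIdeal _ hp) ?_ ?_
  · intro i j p hp
    rw [Submodule.restrictScalars_mem, RingHom.mem_ker] at hp ⊢
    exact (gramHom_symPol ε i j p).trans (by rw [hp, map_zero])
  · intro μ p hp
    rw [Submodule.restrictScalars_mem, RingHom.mem_ker] at hp ⊢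
    rw [algHom_weightedHomogeneousComponent _ (gramHom_X_weight ε), hp, map_zero]
  · intro i j p hp
    rw [Submodule.restrictScalars_mem, RingHom.mem_ker] at hp ⊢
    rw [gramHom_rename, hp, map_zero]
  · intro p hp μ hμ hwt hpol
    rw [Submodule.restrictScalars_mem, RingHom.mem_ker] at hp
    -- The image of p for ε is zero and carries no information; the hyperbolic form classifies p
    -- instead, since its Gram map is injective and commutes with polarization.
    obtain ⟨κ, hκ, c, hc⟩ := exists_eq_gramHom_leadProd (hyperbolicCoeff_eq m) hμ
      (gramHom_mem_diagInvariants _ p)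
      (IsWeightedHomogeneous.algHom _ (gramHom_X_weight (hyperbolicCoeff m)) hwt)
      fun i j hij => by
        rw [← gramHom_symPol]
        exact (congrArg _ (hpol i j hij)).trans (map_zero _)
    obtain rfl := gramHom_hyperbolicCoeff_injective m hc
    by_cases h : ∃ i : Fin m, N ≤ i ∧ κ i ≠ 0
    · obtain ⟨i, hi, hκi⟩ := h
      exact Ideal.mul_mem_left _ _ (leadProd_mem_minorIdeal hκ hκi hi)
    · push Not at h
      have h1 := eval_stdFrame_leadProd_ne_zero (m := m) hε h
      have h2 := congrArg (eval (Function.uncurry (stdFrame m N))) hp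
      rw [map_zero, map_mul, map_mul, ← algebraMap_eq, AlgHom.commutes, algebraMap_eq,
        eval_C] at h2
      rw [(mul_eq_zero.1 h2).resolve_right h1, C_0, zero_mul]
      exact zero_mem _

end Fundamental

end

end OrthogonalInvariants

namespace OrthogonalInvariants

noncomputable section

open MvPolynomial

/-! ### Transfer to an arbitrary quadratic space -/

section Transfer

variable {E : Type*} [AddCommGroup E] [Module ℝ E] {m N : ℕ}

theorem exists_diagForm [FiniteDimensional ℝ E] (g : LinearMap.BilinForm ℝ E) (hsymm : g.IsSymm)
    (hnondeg : g.Nondegenerate) :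
    ∃ ε : Fin (Module.finrank ℝ E) → ℝ, (∀ a, ε a = -1 ∨ ε a = 1) ∧
      ∃ e : E ≃ₗ[ℝ] (Fin (Module.finrank ℝ E) → ℝ), ∀ u v, g u v = diagForm ε (e u) (e v) := by
  have hassoc : QuadraticMap.associated (R := ℝ) (LinearMap.BilinMap.toQuadraticMap g) = g :=
    QuadraticMap.associated_left_inverse ℝ hsymm.eq
  obtain ⟨ε, hε, ⟨e⟩⟩ := QuadraticForm.equivalent_one_neg_one_weighted_sum_squared
    (LinearMap.BilinMap.toQuadraticMap g) (by rw [hassoc]; exact hnondeg.1)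
  refine ⟨ε, hε, e.toLinearEquiv, fun u v => ?_⟩
  have h : ∀ u, g u u = diagForm ε (e.toLinearEquiv u) (e.toLinearEquiv u) := by
    intro u
    have := e.map_app u
    rw [QuadraticMap.weightedSumSquares_apply] at this
    rw [diagForm_apply, ← LinearMap.BilinMap.toQuadraticMap_apply, ← this]
    refine Finset.sum_congr rfl fun a _ => ?_
    rw [smul_eq_mul, mul_assoc]
    rfl
  -- The quadratic forms agree; polarizing recovers the bilinear identity.
  have h1 := h (u + v)
  simp only [map_add, LinearMap.add_apply, ← h] at h1
  have h2 : g v u = g u v := hsymm.eq v u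
  have h3 := diagForm_comm ε (e.toLinearEquiv v) (e.toLinearEquiv u)
  linarith

/-- The polynomial function on `m` vectors of `E` given by a polynomial in their coordinates. -/
def coordHom (e : E ≃ₗ[ℝ] (Fin N → ℝ)) :
    MvPolynomial (Fin m × Fin N) ℝ →ₐ[ℝ] ((Fin m → E) → ℝ) :=
  aeval fun s x => e (x s.1) s.2

theorem coordHom_apply (e : E ≃ₗ[ℝ] (Fin N → ℝ)) (p : MvPolynomial (Fin m × Fin N) ℝ)
    (x : Fin m → E) : coordHom e p x = eval (Function.uncurry fun i => e (x i)) p := by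
  induction p using MvPolynomial.induction_on with
  | C a => simp [← algebraMap_eq]
  | add p q hp hq => simp [hp, hq]
  | mul_X p s hp => rw [map_mul, Pi.mul_apply, hp, map_mul, eval_X]; simp [coordHom]; exact Or.inl rfl

theorem coordHom_injective (e : E ≃ₗ[ℝ] (Fin N → ℝ)) :
    Function.Injective (coordHom (m := m) e) := by
  intro p q h
  refine MvPolynomial.funext fun y => ?_
  have := congrFun h fun i => e.symm (Function.curry y i)
  simpa only [coordHom_apply, LinearEquiv.apply_symm_apply, Function.uncurry_curry] using this

/-- Every linear form on m vectors is a combination of their coordinates, so both algebras have the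
same generators up to linear span. -/
theorem range_coordHom (e : E ≃ₗ[ℝ] (Fin N → ℝ)) :
    (coordHom (m := m) e).range = polynomialFunctions (Fin m → E) := by
  rw [coordHom, ← Algebra.adjoin_range_eq_range_aeval, polynomialFunctions]
  refine le_antisymm (Algebra.adjoin_le ?_) (Algebra.adjoin_le ?_)
  · rintro _ ⟨s, rfl⟩
    exact Algebra.subset_adjoin
      ⟨LinearMap.proj s.2 ∘ₗ (e : E →ₗ[ℝ] (Fin N → ℝ)) ∘ₗ LinearMap.proj s.1, rfl⟩
  · rintro _ ⟨φ, rfl⟩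
    have h : (φ : (Fin m → E) → ℝ) = ∑ i, ∑ a,
        φ (Pi.single i (e.symm (Pi.single a 1))) • fun x : Fin m → E => e (x i) a := by
      funext x
      have h1 : x = ∑ i, ∑ a, e (x i) a • Pi.single i (e.symm (Pi.single a 1)) := by
        have h2 : ∀ i, x i = ∑ a, e (x i) a • e.symm (Pi.single a 1) := by
          intro i
          apply e.injective
          funext b
          simp [map_sum, Finset.sum_apply, Pi.single_apply]
        conv_lhs => rw [← Finset.univ_sum_single x]
        refine Finset.sum_congr rfl fun i _ => ?_
        conv_lhs => rw [h2 i]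
        simp only [← Pi.single_smul]
        exact map_sum (LinearMap.single ℝ (fun _ => E) i) _ _
      conv_lhs => rw [h1]
      simp [map_sum, Finset.sum_apply, mul_comm]
    beta_reduce
    rw [h]
    exact sum_mem fun i _ => sum_mem fun a _ =>
      Subalgebra.smul_mem _ (Algebra.subset_adjoin (by exact ⟨(i, a), rfl⟩)) _

variable {g : LinearMap.BilinForm ℝ E} {ε : Fin N → ℝ} {e : E ≃ₗ[ℝ] (Fin N → ℝ)}

theorem coordHom_gramHom (he : ∀ u v, g u v = diagForm ε (e u) (e v)) :
    (coordHom e).comp (gramHom ε) =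
      aeval fun s : SymIndex m => metricFunction g s.1.1 s.1.2 := by
  ext1 s
  funext x
  rw [AlgHom.comp_apply, coordHom_apply, eval_gramHom, eval_X, aeval_X, metricFunction, he]

theorem mem_diagInvariants_of_coordHom_mem (he : ∀ u v, g u v = diagForm ε (e u) (e v))
    {p : MvPolynomial (Fin m × Fin N) ℝ} (hp : coordHom e p ∈ invariantPolynomials g m) :
    p ∈ diagInvariants m ε := by
  rw [mem_diagInvariants_iff_eval]
  intro A hA x
  have h := hp.2 (e.trans (A.trans e.symm)) (fun u v => by
    rw [he, he]
    simpa using hA (e u) (e v)) fun i => e.symm (x i)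
  simpa [coordHom_apply] using h

theorem range_aeval_metricFunction (hε : ∀ a, ε a = -1 ∨ ε a = 1)
    (he : ∀ u v, g u v = diagForm ε (e u) (e v)) :
    (aeval (R := ℝ) fun s : SymIndex m => metricFunction g s.1.1 s.1.2).range =
      invariantPolynomials g m := by
  rw [← coordHom_gramHom he]
  ext f
  constructor
  · rintro ⟨p, rfl⟩
    refine ⟨?_, fun A hA x => ?_⟩
    · rw [← range_coordHom e]
      exact ⟨gramHom ε p, rfl⟩
    · change coordHom e (gramHom ε p) _ = coordHom e (gramHom ε p) _
      rw [coordHom_apply, coordHom_apply, eval_gramHom, eval_gramHom]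
      simp only [← he]
      congr 2
      funext s
      exact hA _ _
  · intro hf
    obtain ⟨p, rfl⟩ : f ∈ (coordHom (m := m) e).range := by
      rw [range_coordHom]
      exact hf.1
    obtain ⟨q, rfl⟩ := diagInvariants_le_range_gramHom hε
      (mem_diagInvariants_of_coordHom_mem he hf)
    exact ⟨q, rfl⟩

theorem ker_aeval_metricFunction (hε : ∀ a, ε a = -1 ∨ ε a = 1)
    (he : ∀ u v, g u v = diagForm ε (e u) (e v)) :
    RingHom.ker (aeval (R := ℝ) fun s : SymIndex m => metricFunction g s.1.1 s.1.2) =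
      minorIdeal m (N + 1) := by
  rw [← coordHom_gramHom he, ← ker_gramHom hε]
  ext p
  rw [RingHom.mem_ker, RingHom.mem_ker, AlgHom.comp_apply]
  exact map_eq_zero_iff _ (coordHom_injective e)

theorem minorIdeal_eq_bot (h : m ≤ N) : minorIdeal m (N + 1) = ⊥ := by
  rw [minorIdeal, Ideal.span_eq_bot]
  rintro _ ⟨r, -, -⟩
  have := Fintype.card_le_of_injective r r.injective
  simp only [Fintype.card_fin] at this
  omega

theorem aeval_metricFunction_symVar (hsymm : g.IsSymm) (i j : Fin m) :
    aeval (R := ℝ) (fun s : SymIndex m => metricFunction g s.1.1 s.1.2) (symVar m i j) =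
      metricFunction g i j := by
  rw [symVar_apply, aeval_X]
  funext x
  rcases le_total i j with h | h
  · simp [symIdx, h]
  · simp only [symIdx, h, inf_of_le_right, sup_of_le_left]
    exact hsymm.eq _ _

end Transfer

end

end OrthogonalInvariants

theorem mainTheorem4 {E : Type*} [AddCommGroup E] [Module ℝ E] [FiniteDimensional ℝ E]
    (g : LinearMap.BilinForm ℝ E) (hsymm : g.IsSymm) (hnondeg : g.Nondegenerate) (m : ℕ) :
    Algebra.adjoin ℝ {f : (Fin m → E) → ℝ |
        ∃ i j : Fin m, i ≤ j ∧ f = OrthogonalInvariants.metricFunction g i j} =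
      OrthogonalInvariants.invariantPolynomials g m ∧
    (∃ Φ : (MvPolynomial (OrthogonalInvariants.SymIndex m) ℝ ⧸
          OrthogonalInvariants.minorIdeal m (Module.finrank ℝ E + 1)) ≃ₐ[ℝ]
        OrthogonalInvariants.invariantPolynomials g m,
      ∀ i j : Fin m,
        ((Φ (Ideal.Quotient.mk _ (OrthogonalInvariants.symVar m i j)) :
            OrthogonalInvariants.invariantPolynomials g m) : (Fin m → E) → ℝ) =
          OrthogonalInvariants.metricFunction g i j) ∧
    (m ≤ Module.finrank ℝ E →
      AlgebraicIndependent ℝ fun p : OrthogonalInvariants.SymIndex m =>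
        OrthogonalInvariants.metricFunction g p.1.1 p.1.2) := by
  obtain ⟨ε, hε, e, he⟩ := OrthogonalInvariants.exists_diagForm g hsymm hnondeg
  have hrange := OrthogonalInvariants.range_aeval_metricFunction (m := m) hε he
  have hker := OrthogonalInvariants.ker_aeval_metricFunction (m := m) hε he
  refine ⟨?_, ?_, fun hm => ?_⟩
  · rw [← hrange, ← Algebra.adjoin_range_eq_range_aeval]
    congr 1
    ext f
    constructor
    · rintro ⟨i, j, hij, rfl⟩
      exact ⟨⟨(i, j), hij⟩, rfl⟩
    · rintro ⟨s, rfl⟩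
      exact ⟨s.1.1, s.1.2, s.2, rfl⟩
  · let Ψ := MvPolynomial.aeval (R := ℝ) fun s : OrthogonalInvariants.SymIndex m =>
      OrthogonalInvariants.metricFunction g s.1.1 s.1.2
    let Φ := (Ideal.quotientEquivAlgOfEq ℝ hker.symm).trans
      ((Ideal.quotientKerEquivRange Ψ).trans (Subalgebra.equivOfEq _ _ hrange))
    exact ⟨Φ, fun i j => OrthogonalInvariants.aeval_metricFunction_symVar hsymm i j⟩
  -- For m ≤ n there are no minors of size n + 1, so the kernel is zero.
  · rw [AlgebraicIndependent, RingHom.injective_iff_ker_eq_bot, hker,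
      OrthogonalInvariants.minorIdeal_eq_bot hm]
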